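/- Let $n\ge 0$, let $X\subseteq\mathbb R^n$ be open, let $Y$ be an open subset of a real Banach space $H$, let $E,F$ be real Banach spaces, and let $1\le p\le\infty$, $0\le q\le\infty$. Let $C^p(X,E)$ be the space of all $C^p$ functions $X\to E$ with the topology generated by the seminorms $\rho_{K,k}(f)=\sup_{x\in K}\sup_{0\le j\le k}\|D^jf(x)\|$ ($K\subseteq X$ compact, $k\in\mathbb N\cup\{0\}$, $k\le p$), and similarly $C^q(Y,F)$. Let $T:C^p(X,E)\to C^q(Y,F)$ be a continuous linear operator that is separating (if for every $x\in X$ one has $f(x)=0$ or $g(x)=0$, then for every $y\in Y$ one has $Tf(y)=0$ or $Tg(y)=0$) and nowhere trivial (for every $y\in Y$ there is $f$ with $Tf(y)\ne0$). The support map of $T$ is defined as follows. Let $\mathbb R_\infty$ be the one-point compactification of $\mathbb R$, let $i:X\to\mathbb R_\infty^{C^p(X,\mathbb R)}$ be $i(x)=(\varphi(x))_\varphi$, and let $\mathcal AX$ be the closure of $i(X)$. For $y\in Y$ let $\mathcal O_y$ be the family of all open $U\subseteq\mathcal AX$ for which there is $f\in C^p(X,E)$ with $Tf(y)\neq0$ and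 $\overline{i(\{x : f(x)\ne 0\})}\subseteq U$. Then for every $y\in Y$ the intersection $\bigcap_{U\in\mathcal O_y}\overline U$ consists of exactly one point, which is of the form $i(h(y))$ with a unique $h(y)\in X$; the map $h=(h_1,\dots,h_n):Y\to X\subseteq\mathbb R^n$ is the support map of $T$. For $k\ge0$, $k\le p$, $y\in Y$ and a bounded symmetric $k$-linear map $S:(\mathbb R^n)^k\to E$ let $\Phi_k(y,S)=\frac1{k!}(Tf_{y,S})(y)$, where $f_{y,S}(x)=S\big((x-h(y))^k\big)$ (these are the coefficients in the representation $Tf(y)=\sum_k\Phi_k(y,D^kf(h(y)))$). For a multiindex $\lambda\in(\mathbb N\cup\{0\})^n$ and $u\in E$ let $S_{\lambda,u}$ be the symmetric $|\lambda|$-linear map with $S_{\lambda,u}x^{|\lambda|}=x^\lambda u$. For $1\le i\le n$ let $U_i$ be the set of all $y_0\in Y$ for which there are $m_0\ge0$ and an open neighborhood $V\subseteq Y$ of $y_0$ such that $\Phi_{|\lambda|}(y,S_{\lambda,u})=0$ for all $y\in V$, $u\in E$ and $\lambda$ with $|\lambda|\le p$ and $\lambda_i>m_0$, and such that $\Phi_{|\mu|}(y_0,S_{\mu,u})\ne0$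 for some $u\in E$ and some multiindex $\mu$ with $|\mu|\le p$ and $\mu_i=m_0$. Then for $1\le i\le n$ the set $U_i$ is open and dense in $Y$ and $h_i$ is $C^q$ on $U_i$. Hence $h$ is $C^q$ on the set $U=\bigcap_{i=1}^nU_i$, which is open and dense in $Y$ (for $n=0$, $U=Y$). -/

import Mathlib

open Set TopologicalSpace
open scoped Nat

noncomputable section

namespace SepMap

section Spaces

variable {G : Type*} [NormedAddCommGroup G] [NormedSpace ℝ G]
variable {E : Type*} [NormedAddCommGroup E] [NormedSpace ℝ E]

/-- Extension by zero to the whole space of a function on the set `X`. -/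
def zeroExt {X : Set G} (f : X → E) : G → E := Function.extend Subtype.val f 0

theorem zeroExt_apply {X : Set G} (f : X → E) (x : X) : zeroExt f x = f x :=
  Subtype.val_injective.extend_apply f 0 x

theorem zeroExt_add {X : Set G} (f g : X → E) : zeroExt (f + g) = zeroExt f + zeroExt g := by
  funext x
  by_cases hx : x ∈ X
  · simp only [Pi.add_apply]
    rw [zeroExt_apply _ ⟨x, hx⟩, zeroExt_apply f ⟨x, hx⟩, zeroExt_apply g ⟨x, hx⟩]; rfl
  · have hne : ¬ ∃ a : X, (a : G) = x := by rintro ⟨a, rfl⟩; exact hx a.2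
    simp [zeroExt, Function.extend_apply' _ _ _ hne]

theorem zeroExt_smul {X : Set G} (c : ℝ) (f : X → E) : zeroExt (c • f) = c • zeroExt f := by
  funext x
  by_cases hx : x ∈ X
  · simp only [Pi.smul_apply]
    rw [zeroExt_apply _ ⟨x, hx⟩, zeroExt_apply f ⟨x, hx⟩]; rfl
  · have hne : ¬ ∃ a : X, (a : G) = x := by rintro ⟨a, rfl⟩; exact hx a.2
    simp [zeroExt, Function.extend_apply' _ _ _ hne]

/-- The function `f`, defined on the set `X`, is of class `C^p` on the subset `W` of `X`
(only used for `W` open in the ambient space). -/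
def IsCkOn (p : ℕ∞) {X : Set G} (f : X → E) (W : Set X) : Prop :=
  ContDiffOn ℝ (p : WithTop ℕ∞) (zeroExt f) (Subtype.val '' W)

/-- The vector space of `C^p` functions `X → E`, as a subspace of all functions. -/
def ckSubmodule (p : ℕ∞) (X : Opens G) (E : Type*) [NormedAddCommGroup E] [NormedSpace ℝ E] :
    Submodule ℝ (X → E) where
  carrier := {f | ContDiffOn ℝ (p : WithTop ℕ∞) (zeroExt (X := (X : Set G)) f) X}
  add_mem' {f g} hf hg := by
    simp only [mem_ofPred_eq] at hf hg ⊢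
    rw [zeroExt_add]; exact hf.add hg
  zero_mem' := by
    have h0 : zeroExt (X := (X : Set G)) (0 : X → E) = 0 := by
      have := zeroExt_smul (X := (X : Set G)) 0 (0 : X → E)
      simpa using this
    simp only [mem_ofPred_eq]
    rw [h0]; exact contDiffOn_const
  smul_mem' c f hf := by
    simp only [mem_ofPred_eq] at hf ⊢
    rw [zeroExt_smul]; exact hf.const_smul c

/-- The space `C^p(X, E)`.  It is not reducible to a subtype, so that it does not carry the
topology of pointwise convergence. -/
def Ck (p : ℕ∞) (X : Opens G) (E : Type*) [NormedAddCommGroup E] [NormedSpace ℝ E] : Type _ :=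
  ckSubmodule p X E

instance (p : ℕ∞) (X : Opens G) : AddCommGroup (Ck p X E) :=
  inferInstanceAs (AddCommGroup (ckSubmodule p X E))

instance (p : ℕ∞) (X : Opens G) : Module ℝ (Ck p X E) :=
  inferInstanceAs (Module ℝ (ckSubmodule p X E))

instance (p : ℕ∞) (X : Opens G) : CoeFun (Ck p X E) (fun _ => X → E) := ⟨fun f => f.1⟩

variable {p : ℕ∞} {X : Opens G}

namespace Ck

/-- The `j`-th Fréchet derivative `D^j f` (used at points of `X` only). -/
def D (j : ℕ) (f : Ck p X E) (x : G) : ContinuousMultilinearMap ℝ (fun _ : Fin j => G) E :=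
  iteratedFDeriv ℝ j (zeroExt (X := (X : Set G)) f) x

theorem contDiffAt (f : Ck p X E) {x : G} (hx : x ∈ X) :
    ContDiffAt ℝ (p : WithTop ℕ∞) (zeroExt (X := (X : Set G)) f) x :=
  (f.2 : ContDiffOn ℝ _ _ _).contDiffAt (X.isOpen.mem_nhds hx)

theorem D_add {j : ℕ} (hj : (j : ℕ∞) ≤ p) (f g : Ck p X E) {x : G} (hx : x ∈ X) :
    D j (f + g) x = D j f x + D j g x := by
  have hj' : ((j : ℕ) : WithTop ℕ∞) ≤ (p : WithTop ℕ∞) := by exact_mod_cast hj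
  have : zeroExt (X := (X : Set G)) (f + g : Ck p X E) =
      zeroExt (X := (X : Set G)) f + zeroExt (X := (X : Set G)) g := zeroExt_add _ _
  unfold D
  rw [this]
  exact iteratedFDeriv_add_apply ((contDiffAt f hx).of_le hj') ((contDiffAt g hx).of_le hj')

theorem D_smul {j : ℕ} (hj : (j : ℕ∞) ≤ p) (c : ℝ) (f : Ck p X E) {x : G} (hx : x ∈ X) :
    D j (c • f) x = c • D j f x := by
  have hj' : ((j : ℕ) : WithTop ℕ∞) ≤ (p : WithTop ℕ∞) := by exact_mod_cast hj
  have : zeroExt (X := (X : Set G)) (c • f : Ck p X E) =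
      c • zeroExt (X := (X : Set G)) f := zeroExt_smul _ _
  unfold D
  rw [this]
  exact iteratedFDeriv_const_smul_apply ((contDiffAt f hx).of_le hj')

theorem continuousOn_D {j : ℕ} (hj : (j : ℕ∞) ≤ p) (f : Ck p X E) :
    ContinuousOn (D j f) X := by
  have hj' : ((j : ℕ) : WithTop ℕ∞) ≤ (p : WithTop ℕ∞) := by exact_mod_cast hj
  have h := (f.2 : ContDiffOn ℝ _ _ _).continuousOn_iteratedFDerivWithin hj'
    X.isOpen.uniqueDiffOn
  exact h.congr fun x hx => (iteratedFDerivWithin_of_isOpen j X.isOpen hx).symm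

end Ck

/-- Index set of the seminorms: compact subsets `K` of `X`, and natural numbers `k ≤ p`. -/
abbrev SeminormIndex (p : ℕ∞) (X : Opens G) : Type _ :=
  {K : Set G // IsCompact K ∧ K ⊆ X} × {k : ℕ // (k : ℕ∞) ≤ p}

instance : Nonempty (SeminormIndex p X) :=
  ⟨⟨∅, isCompact_empty, empty_subset _⟩, ⟨0, by simp⟩⟩

theorem bddAbove_D (i : SeminormIndex p X) (f : Ck p X E) :
    BddAbove (range fun a : i.1.1 × Fin (i.2.1 + 1) => ‖Ck.D a.2 f a.1‖) := by
  obtain ⟨⟨K, hK, hKX⟩, ⟨k, hk⟩⟩ := i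
  have hle : ∀ j : Fin (k + 1), ((j : ℕ) : ℕ∞) ≤ p := fun j =>
    le_trans (by exact_mod_cast Nat.lt_succ_iff.mp j.2) hk
  have h : ∀ j : Fin (k + 1), ∃ C, ∀ x ∈ K, ‖Ck.D j f x‖ ≤ C := fun j =>
    hK.exists_bound_of_continuousOn ((Ck.continuousOn_D (hle j) f).mono hKX)
  choose C hC using h
  refine ⟨∑ j, |C j|, ?_⟩
  rintro _ ⟨⟨x, j⟩, rfl⟩
  calc ‖Ck.D j f x‖ ≤ C j := hC j x x.2
    _ ≤ |C j| := le_abs_self _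
    _ ≤ ∑ j, |C j| := Finset.single_le_sum (f := fun j => |C j|)
        (fun _ _ => abs_nonneg _) (Finset.mem_univ j)

/-- The seminorms `ρ_{K,k}(f) = sup_{x ∈ K} sup_{0 ≤ j ≤ k} ‖D^j f(x)‖` on `C^p(X, E)`. -/
def rho (p : ℕ∞) (X : Opens G) (E : Type*) [NormedAddCommGroup E] [NormedSpace ℝ E] :
    SeminormFamily ℝ (Ck p X E) (SeminormIndex p X) := fun i =>
  Seminorm.of (fun f => ⨆ a : i.1.1 × Fin (i.2.1 + 1), ‖Ck.D a.2 f a.1‖)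
    (fun f g => by
      have hle : ∀ j : Fin (i.2.1 + 1), ((j : ℕ) : ℕ∞) ≤ p := fun j =>
        le_trans (by exact_mod_cast Nat.lt_succ_iff.mp j.2) i.2.2
      rcases isEmpty_or_nonempty (i.1.1 × Fin (i.2.1 + 1)) with he | he
      · simp [Real.iSup_of_isEmpty]
      · refine ciSup_le fun a => ?_
        rw [Ck.D_add (hle a.2) f g (i.1.2.2 a.1.2)]
        exact (norm_add_le _ _).trans
          (add_le_add (le_ciSup (bddAbove_D i f) a) (le_ciSup (bddAbove_D i g) a)))
    (fun c f => by
      have hle : ∀ j : Fin (i.2.1 + 1), ((j : ℕ) : ℕ∞) ≤ p := fun j =>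
        le_trans (by exact_mod_cast Nat.lt_succ_iff.mp j.2) i.2.2
      rw [Real.mul_iSup_of_nonneg (norm_nonneg c)]
      congr 1
      funext a
      rw [Ck.D_smul (hle a.2) c f (i.1.2.2 a.1.2), norm_smul])

/-- The topology of `C^p(X, E)` is the one generated by the seminorms `ρ_{K,k}`. -/
instance : TopologicalSpace (Ck p X E) := (rho p X E).moduleFilterBasis.topology

theorem withSeminorms_rho : WithSeminorms (rho p X E) := ⟨rfl⟩

/-! ### The compactification of `X` determined by `C^p(X)` -/

/-- The evaluation map `x ↦ (f(x))_f` into the power of the one-point compactification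
of `ℝ` over the index set `C^p(X)`. -/
def evalMap (p : ℕ∞) (X : Opens G) (x : X) : Ck p X ℝ → OnePoint ℝ :=
  fun f => ((f x : ℝ) : OnePoint ℝ)

/-- The `C^p(X)`-compactification of `X`: the closure of the image of `evalMap`. -/
abbrev Compactif (p : ℕ∞) (X : Opens G) : Type _ :=
  ↥(closure (range (evalMap p X)))

/-- The canonical embedding `i` of `X` into its compactification. -/
def emb (p : ℕ∞) (X : Opens G) (x : X) : Compactif p X :=
  ⟨evalMap p X x, subset_closure (mem_range_self x)⟩

/-- The closure in the compactification of the image of `{x | f x ≠ 0}`. -/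
def suppClosure (f : Ck p X E) : Set (Compactif p X) :=
  closure (emb p X '' {x | f x ≠ 0})

end Spaces

section Operators

variable {G : Type*} [NormedAddCommGroup G] [NormedSpace ℝ G]
variable {H : Type*} [NormedAddCommGroup H] [NormedSpace ℝ H]
variable {E : Type*} [NormedAddCommGroup E] [NormedSpace ℝ E]
variable {F : Type*} [NormedAddCommGroup F] [NormedSpace ℝ F]
variable {p q : ℕ∞} {X : Opens G} {Y : Opens H}

/-- Two functions are disjoint if at each point at least one of them vanishes. -/
def DisjointFun {A B : Type*} [Zero B] (f g : A → B) : Prop := ∀ x, f x = 0 ∨ g x = 0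

/-- Separating (disjointness preserving) operators. -/
def IsSeparating (T : Ck p X E →L[ℝ] Ck q Y F) : Prop :=
  ∀ f g : Ck p X E, DisjointFun f g → DisjointFun (T f) (T g)

/-- `T` is nowhere trivial: at each `y ∈ Y` some `T f` does not vanish. -/
def IsNowhereTrivial (T : Ck p X E →L[ℝ] Ck q Y F) : Prop :=
  ∀ y : Y, ∃ f : Ck p X E, T f y ≠ 0

/-- The family `𝒪_y` of all open sets `U` of the compactification that contain the closed
support of some `f` with `T f (y) ≠ 0`. -/
def openFamily (T : Ck p X E →L[ℝ] Ck q Y F) (y : Y) : Set (Set (Compactif p X)) :=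
  {U | IsOpen U ∧ ∃ f : Ck p X E, T f y ≠ 0 ∧ suppClosure f ⊆ U}

/-- `h` is the support map of `T` (with `X` identified with its image in the compactification):
`h y` is the only point of the intersection of the closures of the members of `𝒪_y`. -/
def IsSupportMap (T : Ck p X E →L[ℝ] Ck q Y F) (h : Y → X) : Prop :=
  ∀ y : Y, ⋂ U ∈ openFamily T y, closure U = {emb p X (h y)}

/-- Bounded symmetric `k`-linear maps from `G^k` to `E`. -/
abbrev SymForm (k : ℕ) (G E : Type*) [NormedAddCommGroup G] [NormedSpace ℝ G]
    [NormedAddCommGroup E] [NormedSpace ℝ E] : Type _ :=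
  {S : ContinuousMultilinearMap ℝ (fun _ : Fin k => G) E //
    ∀ (σ : Equiv.Perm (Fin k)) (v : Fin k → G), S (v ∘ σ) = S v}

/-- The function `x ↦ S((x - a)^k)` on `X`. -/
def powFun (p : ℕ∞) (X : Opens G) {k : ℕ} (S : SymForm k G E) (a : G) : Ck p X E :=
  ⟨fun x => S.1 (fun _ => (x : G) - a), by
    have hS : ContDiff ℝ (p : WithTop ℕ∞) (fun x : G => S.1 (fun _ => x - a)) :=
      S.1.contDiff.comp (contDiff_pi.2 fun _ => contDiff_id.sub contDiff_const)
    exact hS.contDiffOn.congr fun x hx => zeroExt_apply (X := (X : Set G)) _ ⟨x, hx⟩⟩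

/-- The coefficients of the representation `T f (y) = ∑ₖ Φₖ(y, D^k f(h(y)))`:
`Φₖ(y, S) = (T f)(y) / k!`, where `f(x) = S((x - h(y))^k)`. -/
def Phi (T : Ck p X E →L[ℝ] Ck q Y F) (h : Y → X) (k : ℕ) (y : Y) (S : SymForm k G E) : F :=
  ((k ! : ℝ)⁻¹) • T (powFun p X S (h y)) y

end Operators

section Euclidean

variable {n : ℕ} {E : Type*} [NormedAddCommGroup E] [NormedSpace ℝ E]

/-- The order of a multiindex. -/
abbrev order (l : Fin n → ℕ) : ℕ := ∑ i, l i

/-- The list of coordinates in which each `i` occurs `l i` times. -/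
def coordList (l : Fin n → ℕ) (j : Fin (order l)) : Fin n := (finSigmaFinEquiv.symm j).1

/-- The multilinear map `(v_1, …, v_k) ↦ (∏ⱼ (v_j)_{c(j)}) u`, `c` the list of coordinates. -/
def monoForm (l : Fin n → ℕ) (u : E) :
    ContinuousMultilinearMap ℝ (fun _ : Fin (order l) => EuclideanSpace ℝ (Fin n)) E :=
  ((ContinuousMultilinearMap.mkPiAlgebra ℝ (Fin (order l)) ℝ).compContinuousLinearMap
    (fun j => EuclideanSpace.proj (coordList l j))).smulRight u

theorem monoForm_apply (l : Fin n → ℕ) (u : E)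
    (v : Fin (order l) → EuclideanSpace ℝ (Fin n)) :
    monoForm l u v = (∏ j, v j (coordList l j)) • u := by
  simp [monoForm]

/-- The symmetric `k`-linear map `S_{l,u}`, `k = |l|`, with `S_{l,u} x^k = x^l u`:
the symmetrization of `monoForm l u`. -/
def symMono (l : Fin n → ℕ) (u : E) : SymForm (order l) (EuclideanSpace ℝ (Fin n)) E :=
  ⟨((order l)! : ℝ)⁻¹ • ∑ σ : Equiv.Perm (Fin (order l)), (monoForm l u).domDomCongr σ, by
    intro τ v
    simp only [smul_apply, sum_apply,
      ContinuousMultilinearMap.domDomCongr_apply, Function.comp_apply]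
    congr 1
    exact Fintype.sum_equiv (Equiv.mulLeft τ) _ _ fun σ => rfl⟩

/-- The defining property of `S_{l,u}`. -/
theorem symMono_diag (l : Fin n → ℕ) (u : E) (x : EuclideanSpace ℝ (Fin n)) :
    (symMono l u).1 (fun _ => x) = (∏ i, x i ^ l i) • u := by
  have hprod : ∏ j : Fin (order l), x (coordList l j) = ∏ i, x i ^ l i := by
    unfold coordList
    rw [Equiv.prod_comp finSigmaFinEquiv.symm (fun s : (i : Fin n) × Fin (l i) => x s.1),
      Fintype.prod_sigma]
    simp
  have hk : (((order l)! : ℕ) : ℝ) ≠ 0 := by exact_mod_cast Nat.factorial_ne_zero _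
  simp only [symMono, smul_apply, sum_apply,
    ContinuousMultilinearMap.domDomCongr_apply, monoForm_apply, hprod, Finset.sum_const,
    Finset.card_univ, Fintype.card_perm, Fintype.card_fin]
  rw [← Nat.cast_smul_eq_nsmul ℝ, inv_smul_smul₀ hk]

variable {H : Type*} [NormedAddCommGroup H] [NormedSpace ℝ H]
variable {F : Type*} [NormedAddCommGroup F] [NormedSpace ℝ F]
variable {p q : ℕ∞} {X : Opens (EuclideanSpace ℝ (Fin n))} {Y : Opens H}

/-- The set `U_i` of all `y₀ ∈ Y` for which there are `m₀ ≥ 0` and an open neighbourhood `V` of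
`y₀` so that `Φ_{|l|}(y, S_{l,u}) = 0` if `y ∈ V`, `u ∈ E` and `l_i > m₀`, and
`Φ_{|m|}(y₀, S_{m,u}) ≠ 0` for some `u ∈ E` and some multiindex `m` with `m_i = m₀`.
(Only multiindices of order at most `p` occur, since `Φₖ` is considered for `k ≤ p` only.) -/
def goodSet (T : Ck p X E →L[ℝ] Ck q Y F) (h : Y → X) (i : Fin n) : Set Y :=
  {y₀ | ∃ m₀ : ℕ, ∃ V : Set Y, IsOpen V ∧ y₀ ∈ V ∧
    (∀ y ∈ V, ∀ u : E, ∀ l : Fin n → ℕ, (order l : ℕ∞) ≤ p → m₀ < l i →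
      Phi T h (order l) y (symMono l u) = 0) ∧
    ∃ (m : Fin n → ℕ) (u : E), (order m : ℕ∞) ≤ p ∧ m i = m₀ ∧
      Phi T h (order m) y₀ (symMono m u) ≠ 0}

end Euclidean

end SepMap

end

noncomputable section

namespace SepMap

open Filter Topology

/-! ### Symmetry of derivatives, Taylor expansion and small cutoffs -/

section Calculus

variable {G : Type*} [NormedAddCommGroup G] [NormedSpace ℝ G]
variable {E : Type*} [NormedAddCommGroup E] [NormedSpace ℝ E]

/-! For each `y` the functional `f ↦ T f y` is supported at a single point `h y`: a compactness
argument gives a support point (`exists_isSuppPt`), separation makes `T f y` vanish as soon as `f`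
vanishes near it, and this forces it to be the point in the definition of the support map.
Continuity of `T` bounds the order of the functional by some `N ≤ p`, locally uniformly in `y`
(`exists_order_near`). So `T f y` depends only on a finite jet of `f` at `h y`, and nowhere
triviality makes some coefficient nonzero (`HasOrderLE.exists_Phi_ne_zero`).

Openness of `goodSet` follows from continuity of the coefficients in `y`, density from choosing the
least possible bound `m₀` on a smaller open set.

For regularity at `y₀`, freeze the variables other than `x_i` in a fixed polynomial `R` and compose
with a dual vector `ψ`. This gives functionals `L y` on real polynomials in one variable. With `c =
h_i(y)` and `M = m₀`, `L y` kills all multiples of `(X - c)^(M+1)` for `y` near `y₀`, while `L y₀`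
does not kill `(X - c)^M` for `c = h_i(y₀)`. The moments `L y (X^k)` are `C^q` in `y`, being scalar
images of `T` applied to fixed functions. The Hankel matrix of the moments is invertible at `y₀`
(`det_hankel_ne_zero`), hence nearby, and Cramer's rule expresses `(M+1) c` as a rational function
of the moments (`det_hankel_mul`). -/

theorem fderiv_continuousMultilinear_apply {k : ℕ} {f : G → (G [×k]→L[ℝ] E)} {x : G}
    (hd : DifferentiableAt ℝ f x) (v : G) (w : Fin k → G) :
    fderiv ℝ f x v w = fderiv ℝ (fun z => f z w) x v :=
  (DFunLike.congr_fun ((ContinuousMultilinearMap.apply ℝ (fun _ : Fin k => G) E w).hasFDerivAt.comp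
    x hd.hasFDerivAt).fderiv v).symm

/-- The iterated derivative of a `C^k` function of real variables is symmetric. -/
theorem iteratedFDeriv_comp_perm_of_contDiffAt {k : ℕ} {f : G → E} {x : G}
    (hf : ContDiffAt ℝ k f x) (σ : Equiv.Perm (Fin k)) (v : Fin k → G) :
    iteratedFDeriv ℝ k f x (v ∘ σ) = iteratedFDeriv ℝ k f x v := by
  induction k generalizing x with
  | zero => congr 1; exact Subsingleton.elim _ _
  | succ k ih =>
    -- Adjacent transpositions generate all permutations, so only these need checking.
    have hσ : σ ∈ Submonoid.closure (range fun i : Fin k ↦ Equiv.swap i.castSucc i.succ) := by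
      rw [Equiv.Perm.mclosure_swap_castSucc_succ]; trivial
    induction hσ using Submonoid.closure_induction generalizing v with
    | one => rfl
    | mul a b _ _ ha hb =>
      rw [Equiv.Perm.coe_mul, ← Function.comp_assoc, hb, ha]
    | mem s hs =>
      obtain ⟨i, rfl⟩ := hs
      simp only
      obtain ⟨k, rfl⟩ : ∃ m, k = m + 1 := ⟨k - 1, by have := i.2; omega⟩
      -- Swapping the two outermost arguments is symmetry of the second derivative of `D^k f`. Any
      -- other adjacent swap leaves the outermost argument alone, and one differentiates the
      -- induction hypothesis, valid at all points near `x`.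
      refine Fin.cases ?_ (fun i => ?_) i
      · have h2 : IsSymmSndFDerivAt ℝ (iteratedFDeriv ℝ k f) x := by
          have : ContDiffAt ℝ 2 (iteratedFDeriv ℝ k f) x :=
            hf.iteratedFDeriv_right (by push_cast; rw [add_assoc, add_comm]; norm_num)
          exact this.isSymmSndFDerivAt (by simp)
        have key : ∀ w : Fin (k + 2) → G, iteratedFDeriv ℝ (k + 2) f x w =
            fderiv ℝ (fderiv ℝ (iteratedFDeriv ℝ k f)) x (w 0) (w 1) (Fin.tail (Fin.tail w)) := by
          intro w
          have hd : DifferentiableAt ℝ (iteratedFDeriv ℝ (k + 1) f) x :=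
            (hf.iteratedFDeriv_right (m := 1) (i := k + 1)
              (by push_cast; rw [add_comm])).differentiableAt (by simp)
          have hd2 : DifferentiableAt ℝ (fderiv ℝ (iteratedFDeriv ℝ k f)) x := by
            have : ContDiffAt ℝ 2 (iteratedFDeriv ℝ k f) x :=
              hf.iteratedFDeriv_right (by push_cast; rw [add_assoc, add_comm]; norm_num)
            exact (this.fderiv_right (m := 1) (by norm_num)).differentiableAt (by simp)
          rw [iteratedFDeriv_succ_apply_left, fderiv_continuousMultilinear_apply hd]
          simp only [iteratedFDeriv_succ_apply_left]
          have h3 : HasFDerivAt (fun z => fderiv ℝ (iteratedFDeriv ℝ k f) z (w 1))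
              ((fderiv ℝ (fderiv ℝ (iteratedFDeriv ℝ k f)) x).flip (w 1)) x := by
            simpa using hd2.hasFDerivAt.clm_apply (hasFDerivAt_const (w 1) x)
          refine (fderiv_continuousMultilinear_apply h3.differentiableAt (w 0)
            (Fin.tail (Fin.tail w))).symm.trans ?_
          rw [h3.fderiv]
          rfl
        rw [key, key, h2.eq]
        have e1 : (v ∘ Equiv.swap (Fin.castSucc 0) (Fin.succ 0) : Fin (k + 2) → G) 0 = v 1 := by
          simp
        have e2 : (v ∘ Equiv.swap (Fin.castSucc 0) (Fin.succ 0) : Fin (k + 2) → G) 1 = v 0 := by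
          simp
        rw [e1, e2]
        congr 1
      · rw [iteratedFDeriv_succ_apply_left, iteratedFDeriv_succ_apply_left]
        have hd : DifferentiableAt ℝ (iteratedFDeriv ℝ (k + 1) f) x :=
          (hf.iteratedFDeriv_right (m := 1) (i := k + 1)
            (by push_cast; rw [add_comm])).differentiableAt (by simp)
        have e0 : (v ∘ Equiv.swap i.succ.castSucc i.succ.succ) 0 = v 0 := by
          simp only [Function.comp_apply]
          rw [Equiv.swap_apply_of_ne_of_ne]
          · simp [Fin.ext_iff]
          · simp [Fin.ext_iff]
        have et : Fin.tail (v ∘ Equiv.swap i.succ.castSucc i.succ.succ) =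
            Fin.tail v ∘ Equiv.swap i.castSucc i.succ := by
          funext j
          simp only [Fin.tail, Function.comp_apply]
          congr 1
          have := (Fin.succ_injective (k + 1)).swap_apply i.castSucc i.succ j
          rw [← this]; simp
        rw [e0, et]
        rw [fderiv_continuousMultilinear_apply hd, fderiv_continuousMultilinear_apply hd]
        congr 1
        apply Filter.EventuallyEq.fderiv_eq
        have hev : ∀ᶠ z in 𝓝 x, ContDiffAt ℝ ((k + 1 : ℕ) : WithTop ℕ∞) f z :=
          (hf.of_le (by exact_mod_cast Nat.le_succ _)).eventually (by simp)
        filter_upwards [hev] with z hz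
        exact ih hz _ _

/-- All derivatives of `f` of order less than `k` vanish at `a`. -/
def VanishesTo (k : ℕ) (f : G → E) (a : G) : Prop :=
  ∀ j < k, iteratedFDeriv ℝ j f a = 0

theorem VanishesTo.congr {k : ℕ} {f g : G → E} {a : G} (hf : VanishesTo k f a)
    (h : f =ᶠ[𝓝 a] g) : VanishesTo k g a := fun j hj => by
  rw [← (h.iteratedFDeriv ℝ j).eq_of_nhds, hf j hj]

/-- By the Leibniz rule: for `j < k + l` every term carries either fewer than `k` derivatives of `χ`
or fewer than `l` of `f`. -/
theorem VanishesTo.smul {k l : ℕ} {χ : G → ℝ} {f : G → E} {a : G}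
    (hχ : ContDiff ℝ (k + l : ℕ) χ) (hf : ContDiff ℝ (k + l : ℕ) f)
    (h1 : VanishesTo k χ a) (h2 : VanishesTo l f a) :
    VanishesTo (k + l) (fun x => χ x • f x) a := by
  intro j hj
  rw [← norm_le_zero_iff]
  refine (norm_iteratedFDeriv_smul_le hχ hf a (by exact_mod_cast hj.le)).trans ?_
  refine Finset.sum_nonpos fun i hi => ?_
  have : i < k ∨ j - i < l := by have := Finset.mem_range.mp hi; omega
  rcases this with h | h
  · simp [h1 i h]
  · simp [h2 _ h]

theorem vanishesTo_one_sub (ℓ : G →L[ℝ] ℝ) (a : G) :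
    VanishesTo 1 (fun x => ℓ x - ℓ a) a := by
  intro j hj
  obtain rfl : j = 0 := by omega
  ext v
  simp

/-- A `C^N` function whose derivatives up to order `N` vanish at `a` has small derivatives
near `a`. -/
theorem exists_iteratedFDeriv_le_of_vanishesTo {N : ℕ} {f : G → E} {a : G}
    (hf : ContDiffAt ℝ N f a) (h : VanishesTo (N + 1) f a) {η : ℝ} (hη : 0 < η) :
    ∃ r > 0, ∀ x ∈ Metric.ball a r, ContDiffAt ℝ N f x ∧
      ∀ j ≤ N, ‖iteratedFDeriv ℝ j f x‖ ≤ η * ‖x - a‖ ^ (N - j) := by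
  have hc : ContinuousAt (iteratedFDeriv ℝ N f) a :=
    (hf.iteratedFDeriv_right (m := 0) (i := N) (by simp)).continuousAt
  have hev : ∀ᶠ z in 𝓝 a, ContDiffAt ℝ (N : ℕ) f z := hf.eventually (by simp)
  have hsmall : ∀ᶠ z in 𝓝 a, ‖iteratedFDeriv ℝ N f z‖ < η := by
    have h0 : Tendsto (fun z => ‖iteratedFDeriv ℝ N f z‖) (𝓝 a) (𝓝 0) := by
      have := hc.norm.tendsto
      simpa only [h N (Nat.lt_succ_self N), norm_zero] using this
    exact h0.eventually_lt_const hη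
  obtain ⟨r, hr, hball⟩ := Metric.eventually_nhds_iff_ball.mp (hev.and hsmall)
  refine ⟨r, hr, fun x hx => ⟨(hball x hx).1, ?_⟩⟩
  -- Descending from order `N`: the mean value inequality on the closed ball of radius `‖x - a‖`
  -- gains one power of `‖x - a‖` for each derivative removed.
  have main : ∀ i ≤ N, ∀ x ∈ Metric.ball a r,
      ‖iteratedFDeriv ℝ (N - i) f x‖ ≤ η * ‖x - a‖ ^ i := by
    intro i
    induction i with
    | zero => intro _ x hx; simpa using (hball x hx).2.le
    | succ i ih =>
      intro hi x hx
      have hxr : ‖x - a‖ < r := by simpa [dist_eq_norm] using hx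
      have hsub : ∀ z ∈ Metric.closedBall a ‖x - a‖, z ∈ Metric.ball a r := fun z hz =>
        Metric.closedBall_subset_ball hxr hz
      have := (convex_closedBall a ‖x - a‖).norm_image_sub_le_of_norm_fderiv_le
        (f := iteratedFDeriv ℝ (N - (i + 1)) f) (𝕜 := ℝ) (C := η * ‖x - a‖ ^ i) (x := a) (y := x)
        (fun z hz => ((hball z (hsub z hz)).1.iteratedFDeriv_right (m := 1) (i := N - (i + 1))
            (by norm_cast; omega)).differentiableAt (by simp))
        (fun z hz => by
          rw [norm_fderiv_iteratedFDeriv, show N - (i + 1) + 1 = N - i by omega]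
          refine (ih (by omega) z (hsub z hz)).trans ?_
          have : ‖z - a‖ ≤ ‖x - a‖ := by simpa [dist_eq_norm] using hz
          gcongr)
        (by simp) (by simp [dist_eq_norm])
      rw [h _ (by omega), sub_zero] at this
      calc _ ≤ _ := this
        _ = _ := by ring
  intro j hj
  have := main (N - j) (by omega) x hx
  rwa [show N - (N - j) = j by omega] at this

theorem norm_iteratedFDeriv_comp_smul_sub_le {χ : G → ℝ} (hχ : ContDiff ℝ (⊤ : ℕ∞) χ)
    (c : ℝ) (a x : G) (j : ℕ) {B : ℝ} (hB : ∀ z, ‖iteratedFDeriv ℝ j χ z‖ ≤ B) :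
    ‖iteratedFDeriv ℝ j (fun z => χ (c • (z - a))) x‖ ≤ |c| ^ j * B := by
  have e : (fun z => χ (c • (z - a))) =
      fun z => (χ ∘ (c • ContinuousLinearMap.id ℝ G : G →L[ℝ] G)) (z - a) := rfl
  rw [e, iteratedFDeriv_comp_sub,
    ContinuousLinearMap.iteratedFDeriv_comp_right _ hχ _ (by exact_mod_cast le_top)]
  refine (ContinuousMultilinearMap.norm_compContinuousLinearMap_le _ _).trans ?_
  rw [Finset.prod_const, Finset.card_univ, Fintype.card_fin, mul_comm]
  have hn : ‖(c • ContinuousLinearMap.id ℝ G : G →L[ℝ] G)‖ ≤ |c| := by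
    rw [norm_smul]
    exact mul_le_of_le_one_right (abs_nonneg c) ContinuousLinearMap.norm_id_le
  gcongr
  exact hB _

/-- A `C^N` function whose derivatives up to order `N` vanish at `a` can be cut off near `a` so
that its derivatives up to order `N` become uniformly small. -/
theorem exists_cutoff_small [FiniteDimensional ℝ G] {N : ℕ} {f : G → E} {a : G}
    (hf : ContDiffAt ℝ N f a) (h : VanishesTo (N + 1) f a) {δ : ℝ} (hδ : 0 < δ) :
    ∃ χ : G → ℝ, ContDiff ℝ (⊤ : ℕ∞) χ ∧ (∀ᶠ x in 𝓝 a, χ x = 1) ∧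
      ∀ x, ∀ j ≤ N, ‖iteratedFDeriv ℝ j (fun z => χ z • f z) x‖ ≤ δ := by
  let b : ContDiffBump (0 : G) := ⟨1, 2, one_pos, one_lt_two⟩
  have hb : ContDiff ℝ (⊤ : ℕ∞) b := b.contDiff
  have hB : ∀ j : ℕ, ∃ B, ∀ z, ‖iteratedFDeriv ℝ j b z‖ ≤ B := fun j => by
    obtain ⟨C, hC⟩ := (b.hasCompactSupport.iteratedFDeriv (𝕜 := ℝ) j).exists_bound_of_continuous
      (hb.continuous_iteratedFDeriv (by exact_mod_cast le_top))
    exact ⟨C, hC⟩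
  choose B' hB' using hB
  set B : ℝ := 1 + ∑ j ∈ Finset.range (N + 1), |B' j| with hBdef
  have hB0 : 0 < B := by positivity
  have hB : ∀ j ≤ N, ∀ z, ‖iteratedFDeriv ℝ j b z‖ ≤ B := fun j hj z => by
    have := Finset.single_le_sum (f := fun j => |B' j|) (fun _ _ => abs_nonneg _)
      (Finset.mem_range.mpr (Nat.lt_succ_of_le hj))
    have := le_abs_self (B' j)
    linarith [hB' j z]
  -- The binomial coefficients of the Leibniz rule sum to at most `2 ^ N`, the bound `‖x - a‖ ≤ 2 *
  -- ε` costs another `2 ^ N`, and `B` bounds the derivatives of the bump.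
  set η : ℝ := δ / (4 ^ N * B) with hηdef
  have hη : 0 < η := by positivity
  obtain ⟨r, hr, hball⟩ := exists_iteratedFDeriv_le_of_vanishesTo hf h hη
  set ε : ℝ := min 1 (r / 3) with hεdef
  have hε : 0 < ε := by positivity
  have hε1 : ε ≤ 1 := min_le_left _ _
  have hεr : 2 * ε < r := by have := min_le_right 1 (r / 3); linarith
  have hχc : ContDiff ℝ (⊤ : ℕ∞) (fun z => b (ε⁻¹ • (z - a))) :=
    hb.comp (contDiff_const.smul (contDiff_id.sub contDiff_const))
  refine ⟨fun z => b (ε⁻¹ • (z - a)), hχc, ?_, ?_⟩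
  · filter_upwards [Metric.ball_mem_nhds a hε] with x hx
    apply b.one_of_mem_closedBall
    have : ‖x - a‖ < ε := by simpa [dist_eq_norm] using hx
    simp only [Metric.mem_closedBall, dist_zero_right, norm_smul, norm_inv, Real.norm_eq_abs,
      abs_of_pos hε]
    rw [inv_mul_le_iff₀ hε]
    change _ ≤ ε * 1
    linarith
  · intro x j hj
    by_cases hx : ‖x - a‖ ≤ 2 * ε
    · have hxr : x ∈ Metric.ball a r := by
        simp only [Metric.mem_ball, dist_eq_norm]; linarith
      -- The Leibniz bound is taken within the ball, since `f` is known to be `C^N` only there.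
      have hle := norm_iteratedFDerivWithin_smul_le (𝕜 := ℝ) (N := (N : ℕ∞))
        (f := fun z => b (ε⁻¹ • (z - a))) (g := f) (s := Metric.ball a r) (x := x) (n := j)
        ((hχc.of_le (by exact_mod_cast le_top)).contDiffOn)
        (fun z hz => (hball z hz).1.contDiffWithinAt)
        Metric.isOpen_ball.uniqueDiffOn hxr (by exact_mod_cast hj)
      simp only [iteratedFDerivWithin_of_isOpen _ Metric.isOpen_ball hxr] at hle
      refine hle.trans ?_
      -- The factor `ε⁻¹ ^ i` from differentiating the rescaled bump is absorbed by the smallness of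
      -- `f`: the exponent `N - (j - i)` is at least `i`, and `ε ≤ 1`.
      have hterm : ∀ i ∈ Finset.range (j + 1),
          (j.choose i : ℝ) * ‖iteratedFDeriv ℝ i (fun z => b (ε⁻¹ • (z - a))) x‖ *
            ‖iteratedFDeriv ℝ (j - i) f x‖ ≤ (j.choose i : ℝ) * (B * η * 2 ^ N) := by
        intro i hi
        have hij : i ≤ j := Nat.lt_succ_iff.mp (Finset.mem_range.mp hi)
        have h1 := norm_iteratedFDeriv_comp_smul_sub_le hb ε⁻¹ a x i (hB i (hij.trans hj))
        have h2 := (hball x hxr).2 (j - i) (by omega)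
        rw [abs_of_pos (by positivity)] at h1
        have h3 : ‖x - a‖ ^ (N - (j - i)) ≤ 2 ^ N * ε ^ i := by
          calc ‖x - a‖ ^ (N - (j - i)) ≤ (2 * ε) ^ (N - (j - i)) := by gcongr
            _ = 2 ^ (N - (j - i)) * ε ^ (N - (j - i)) := mul_pow _ _ _
            _ ≤ 2 ^ N * ε ^ i := by
              gcongr ?_ * ?_
              · exact pow_le_pow_right₀ (by norm_num) (by omega)
              · exact pow_le_pow_of_le_one hε.le hε1 (by omega)
        rw [mul_assoc]
        refine mul_le_mul_of_nonneg_left ?_ (by positivity)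
        calc _ ≤ (ε⁻¹ ^ i * B) * (η * (2 ^ N * ε ^ i)) := by
              have h4 := h2.trans (mul_le_mul_of_nonneg_left h3 hη.le)
              exact mul_le_mul h1 h4 (norm_nonneg _) (by positivity)
          _ = (ε⁻¹ * ε) ^ i * (B * η * 2 ^ N) := by rw [mul_pow]; ring
          _ = _ := by rw [inv_mul_cancel₀ hε.ne', one_pow, one_mul]
      refine (Finset.sum_le_sum hterm).trans ?_
      rw [← Finset.sum_mul]
      have hs : ∑ i ∈ Finset.range (j + 1), (j.choose i : ℝ) = 2 ^ j := by
        exact_mod_cast Nat.sum_range_choose j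
      rw [hs]
      calc (2 : ℝ) ^ j * (B * η * 2 ^ N) ≤ 2 ^ N * (B * η * 2 ^ N) := by
            gcongr
            norm_num
        _ = 4 ^ N * B * η := by
            rw [show (4 : ℝ) = 2 * 2 by norm_num, mul_pow]; ring
        _ = δ := by rw [hηdef]; field_simp
    · have hz : (fun z => b (ε⁻¹ • (z - a)) • f z) =ᶠ[𝓝 x] fun _ => 0 := by
        have : {z : G | 2 * ε < ‖z - a‖} ∈ 𝓝 x :=
          (isOpen_lt continuous_const (continuous_id.sub continuous_const).norm).mem_nhds
            (not_le.mp hx)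
        filter_upwards [this] with z hz
        rw [b.zero_of_le_dist, zero_smul]
        simp only [dist_zero_right, norm_smul, norm_inv, Real.norm_eq_abs, abs_of_pos hε]
        rw [le_inv_mul_iff₀ hε]
        change ε * 2 ≤ _
        have : 2 * ε < ‖z - a‖ := hz
        linarith
      rw [(hz.iteratedFDeriv ℝ j).eq_of_nhds]
      have : iteratedFDeriv ℝ j (fun _ : G => (0 : E)) x = 0 := by
        rw [show (fun _ : G => (0 : E)) = 0 from rfl]; simp
      rw [this, norm_zero]; exact hδ.le

/-- Subtracting the homogeneous Taylor polynomial of degree `k` raises the order of vanishing. -/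
theorem VanishesTo.sub_taylor {k : ℕ} {f : G → E} {a : G}
    (hf : ContDiffAt ℝ k f a) (h : VanishesTo k f a) :
    VanishesTo (k + 1)
      (fun x => f x - (k ! : ℝ)⁻¹ • iteratedFDeriv ℝ k f a (fun _ => x - a)) a := by
  set A := iteratedFDeriv ℝ k f a with hA
  have hcd : ContDiff ℝ (k : ℕ) (fun x : G => A fun _ => x - a) :=
    A.contDiff.comp (contDiff_pi.2 fun _ => contDiff_id.sub contDiff_const)
  intro j hj
  have hjk : j ≤ k := by omega
  have e1 : iteratedFDeriv ℝ j
      (fun x => f x - (k ! : ℝ)⁻¹ • A (fun _ => x - a)) a =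
      iteratedFDeriv ℝ j f a -
        (k ! : ℝ)⁻¹ • iteratedFDeriv ℝ j (fun x : G => A fun _ => x - a) a := by
    have hle : ((j : ℕ) : WithTop ℕ∞) ≤ (k : ℕ) := by exact_mod_cast hjk
    have hs : ContDiffAt ℝ j (fun x : G => A fun _ => x - a) a := (hcd.of_le hle).contDiffAt
    rw [← iteratedFDeriv_const_smul_apply hs]
    exact iteratedFDeriv_sub_apply (hf.of_le hle) (hs.const_smul _)
  rw [e1]
  rcases hjk.lt_or_eq with hlt | rfl
  -- Below degree `k`, a homogeneous polynomial of degree `k` has vanishing derivatives at its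
  -- centre.
  · rw [h j hlt, zero_sub, neg_eq_zero]
    rw [smul_eq_zero]
    right
    let g : G →L[ℝ] (Fin k → G) := ContinuousLinearMap.pi fun _ => ContinuousLinearMap.id ℝ G
    rw [show (fun x : G => A fun _ => x - a) = fun x => (A ∘ g) (x - a) from rfl,
      iteratedFDeriv_comp_sub,
      ContinuousLinearMap.iteratedFDeriv_comp_right _ A.contDiff _ le_rfl, sub_self, map_zero]
    have h0 : iteratedFDeriv ℝ j A 0 = 0 := by
      rw [← norm_le_zero_iff]
      refine (A.norm_iteratedFDeriv_le j 0).trans ?_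
      simp [Nat.sub_ne_zero_of_lt hlt]
    rw [h0]; ext v; simp
  -- In degree `k` itself, the derivative of the diagonal of `A` is a sum over all permutations;
  -- symmetry of `A` turns it into `k! A`.
  · have e2 : iteratedFDeriv ℝ j (fun x : G => A fun _ => x - a) a = (j ! : ℝ) • A := by
      ext v
      rw [show (fun x : G => A fun _ => x - a) = fun x => (fun z => A fun _ => z) (x - a) from rfl,
        iteratedFDeriv_comp_sub (f := fun z => A fun _ => z), ContinuousMultilinearMap.iteratedFDeriv_comp_diagonal]
      have : ∀ σ : Equiv.Perm (Fin j), A (fun i => v (σ i)) = A v := fun σ =>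
        iteratedFDeriv_comp_perm_of_contDiffAt hf σ v
      simp [this, Fintype.card_perm]
      rw [Nat.cast_smul_eq_nsmul]
    rw [e2, inv_smul_smul₀ (by positivity), sub_self]

end Calculus

/-! ### Support points, the support map and local finiteness of the order -/

section Support

variable {G : Type*} [NormedAddCommGroup G] [NormedSpace ℝ G]
variable {H : Type*} [NormedAddCommGroup H] [NormedSpace ℝ H]
variable {E : Type*} [NormedAddCommGroup E] [NormedSpace ℝ E]
variable {F : Type*} [NormedAddCommGroup F] [NormedSpace ℝ F]
variable {p q : ℕ∞} {X : Opens G} {Y : Opens H}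

theorem zeroExt_of_notMem {X : Set G} (f : X → E) {x : G} (hx : x ∉ X) : zeroExt f x = 0 := by
  have hne : ¬ ∃ a : X, (a : G) = x := by rintro ⟨a, rfl⟩; exact hx a.2
  simp [zeroExt, Function.extend_apply' _ _ _ hne]

theorem zeroExt_smul_fun {X : Set G} (χ : G → ℝ) (f : X → E) :
    zeroExt (fun x : X => χ x • f x) = fun x => χ x • zeroExt f x := by
  funext x
  by_cases hx : x ∈ X
  · rw [zeroExt_apply _ ⟨x, hx⟩, zeroExt_apply f ⟨x, hx⟩]
  · rw [zeroExt_of_notMem _ hx, zeroExt_of_notMem _ hx, smul_zero]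

namespace Ck

@[ext] theorem ext {f g : Ck p X E} (h : ∀ x, f x = g x) : f = g := Subtype.ext (funext h)

theorem add_apply (f g : Ck p X E) (x : X) : (f + g) x = f x + g x := rfl

theorem sub_apply (f g : Ck p X E) (x : X) : (f - g) x = f x - g x := rfl

theorem smul_apply (c : ℝ) (f : Ck p X E) (x : X) : (c • f) x = c • f x := rfl

theorem zeroExt_coe (f : Ck p X E) (x : X) : zeroExt (X := (X : Set G)) f x = f x :=
  zeroExt_apply (X := (X : Set G)) f x

theorem continuous (f : Ck p X E) : Continuous f := by
  have h : ContinuousOn (zeroExt (X := (X : Set G)) f) X := (f.2 : ContDiffOn ℝ _ _ _).continuousOn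
  refine (continuousOn_iff_continuous_domRestrict.mp h).congr fun x => ?_
  exact zeroExt_coe f x

/-- The product of a function in `C^p(X, E)` with a smooth scalar function. -/
def mulSmooth (χ : G → ℝ) (hχ : ContDiff ℝ (⊤ : ℕ∞) χ) (f : Ck p X E) : Ck p X E :=
  ⟨fun x => χ x • f x, by
    have h := (hχ.of_le (m := (p : WithTop ℕ∞)) (by exact_mod_cast le_top)).contDiffOn.smul
      (f.2 : ContDiffOn ℝ _ _ _)
    refine h.congr fun x hx => ?_
    exact congrFun (zeroExt_smul_fun (X := (X : Set G)) χ f) x⟩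

theorem mulSmooth_apply (χ : G → ℝ) (hχ : ContDiff ℝ (⊤ : ℕ∞) χ) (f : Ck p X E) (x : X) :
    mulSmooth χ hχ f x = χ x • f x := rfl

theorem zeroExt_mulSmooth (χ : G → ℝ) (hχ : ContDiff ℝ (⊤ : ℕ∞) χ) (f : Ck p X E) :
    zeroExt (X := (X : Set G)) (mulSmooth χ hχ f) = fun x => χ x • zeroExt (X := (X : Set G)) f x :=
  zeroExt_smul_fun (X := (X : Set G)) χ f

end Ck

theorem norm_le_rho (i : SeminormIndex p X) (f : Ck p X E) {x : X} (hx : (x : G) ∈ i.1.1) :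
    ‖f x‖ ≤ rho p X E i f := by
  have h := le_ciSup (bddAbove_D i f) (⟨x, hx⟩, 0)
  have e : ‖Ck.D ((0 : Fin (i.2.1 + 1)) : ℕ) f x‖ = ‖f x‖ := by
    rw [Ck.D, Fin.val_zero, norm_iteratedFDeriv_zero]
    exact congrArg norm (Ck.zeroExt_coe f x)
  rw [← e]
  exact h

theorem rho_le {i : SeminormIndex p X} {f : Ck p X E} {δ : ℝ} (hδ : 0 ≤ δ)
    (h : ∀ x ∈ i.1.1, ∀ j ≤ i.2.1, ‖Ck.D j f x‖ ≤ δ) : rho p X E i f ≤ δ :=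
  Real.iSup_le (fun a => h a.1 a.1.2 a.2 (Nat.lt_succ_iff.mp a.2.2)) hδ

/-- On a compact set of points `y`, the functionals `f ↦ T f y` are uniformly bounded by one
of the seminorms. -/
theorem exists_bound_on_compact (T : Ck p X E →L[ℝ] Ck q Y F) {L : Set H} (hL : IsCompact L)
    (hLY : L ⊆ Y) :
    ∃ K : Set G, IsCompact K ∧ K ⊆ X ∧ ∃ N : ℕ, (N : ℕ∞) ≤ p ∧ ∃ C : ℝ, 0 ≤ C ∧
      ∀ y : Y, (y : H) ∈ L → ∀ (f : Ck p X E) (δ : ℝ), 0 ≤ δ →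
        (∀ x ∈ K, ∀ j ≤ N, ‖Ck.D j f x‖ ≤ δ) → ‖T f y‖ ≤ C * δ := by
  let i₀ : SeminormIndex q Y := (⟨L, hL, hLY⟩, ⟨0, by simp⟩)
  have hcont : Continuous ((rho q Y F i₀).comp T.toLinearMap) :=
    (withSeminorms_rho.continuous_seminorm i₀).comp T.continuous
  obtain ⟨s, C, -, hC⟩ := Seminorm.bound_of_continuous withSeminorms_rho _ hcont
  have : Nonempty {k : ℕ // (k : ℕ∞) ≤ p} := ⟨⟨0, by simp⟩⟩
  -- Taking the upper bound inside the subtype keeps the common order at most `p`.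
  obtain ⟨M, hM⟩ := (s.image fun i => i.2).exists_le
  refine ⟨⋃ i ∈ s, i.1.1, s.isCompact_biUnion fun i _ => i.1.2.1,
    iUnion₂_subset fun i _ => i.1.2.2, M.1, M.2, C, C.2, fun y hy f δ hδ h => ?_⟩
  calc ‖T f y‖ ≤ rho q Y F i₀ (T f) := norm_le_rho i₀ (T f) hy
    _ ≤ C * (s.sup (rho p X E)) f := hC f
    _ ≤ C * δ := by
      gcongr
      refine Seminorm.finset_sup_apply_le hδ fun i hi => rho_le hδ fun x hx j hj => ?_
      exact h x (mem_biUnion hi hx) j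
        (hj.trans (Subtype.coe_le_coe.mpr (hM i.2 (Finset.mem_image_of_mem _ hi))))

/-- `x` is in the support of the functional `f ↦ T f y`. -/
def IsSuppPt (T : Ck p X E →L[ℝ] Ck q Y F) (y : Y) (x : X) : Prop :=
  ∀ W ∈ 𝓝 (x : G), ∃ f : Ck p X E, (∀ z : X, (z : G) ∉ W → f z = 0) ∧ T f y ≠ 0

theorem D_eq_zero_of_eventually {f : Ck p X E} {x : G}
    (h : ∀ᶠ z in 𝓝 x, zeroExt (X := (X : Set G)) f z = 0) (j : ℕ) : Ck.D j f x = 0 := by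
  have : zeroExt (X := (X : Set G)) f =ᶠ[𝓝 x] (0 : G → E) := h
  unfold Ck.D
  rw [(this.iteratedFDeriv ℝ j).eq_of_nhds]
  simp

/-- `T f y` is controlled by derivatives of `f` on a compact `K`. If no point of `K` is a support
point, each has a neighbourhood on which `f` can be cut to zero without changing `T f y`. Finitely
many such cutoffs multiply to one that vanishes near `K`, so `T f y = 0` for every `f`. -/
theorem exists_isSuppPt [FiniteDimensional ℝ G] (T : Ck p X E →L[ℝ] Ck q Y F) {y : Y}
    (hnt : ∃ f : Ck p X E, T f y ≠ 0) : ∃ x : X, IsSuppPt T y x := by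
  by_contra! hno
  obtain ⟨K, hK, hKX, N, -, C, -, hC⟩ :=
    exists_bound_on_compact T (isCompact_singleton (x := (y : H))) (by simp)
  obtain ⟨χ, hχ, hχ0, hχT⟩ : ∃ (χ : G → ℝ) (hχ : ContDiff ℝ (⊤ : ℕ∞) χ),
      (∀ᶠ z in 𝓝ˢ K, χ z = 0) ∧ ∀ f : Ck p X E, T f y = T (Ck.mulSmooth χ hχ f) y := by
    refine hK.induction_on (p := fun S => ∃ (χ : G → ℝ) (hχ : ContDiff ℝ (⊤ : ℕ∞) χ),
      (∀ᶠ z in 𝓝ˢ S, χ z = 0) ∧ ∀ f : Ck p X E, T f y = T (Ck.mulSmooth χ hχ f) y) ?_ ?_ ?_ ?_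
    · refine ⟨fun _ => 1, contDiff_const, by simp, fun f => ?_⟩
      refine congrArg (fun g => T g y) (Ck.ext fun x => ?_)
      simp [Ck.mulSmooth_apply]
    · rintro s t hst ⟨χ, hχ, h0, hT⟩
      exact ⟨χ, hχ, h0.filter_mono (nhdsSet_mono hst), hT⟩
    · rintro s t ⟨χ₁, hχ₁, h01, hT1⟩ ⟨χ₂, hχ₂, h02, hT2⟩
      refine ⟨fun z => χ₁ z * χ₂ z, hχ₁.mul hχ₂, ?_, fun f => ?_⟩
      · rw [nhdsSet_union, eventually_sup]
        exact ⟨h01.mono fun z hz => by simp [hz], h02.mono fun z hz => by simp [hz]⟩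
      · rw [hT2, hT1]
        refine congrArg (fun g => T g y) (Ck.ext fun x => ?_)
        simp [Ck.mulSmooth_apply, mul_smul]
    · intro x hx
      have hns := hno ⟨x, hKX hx⟩
      simp only [IsSuppPt, not_forall, not_exists, not_and, not_not] at hns
      obtain ⟨W, hW, hWT⟩ := hns
      obtain ⟨r, hr, hrW⟩ := Metric.nhds_basis_closedBall.mem_iff.mp hW
      let b : ContDiffBump x := ⟨r / 2, r, by positivity, by linarith⟩
      have hb : ContDiff ℝ (⊤ : ℕ∞) b := b.contDiff
      refine ⟨Metric.ball x (r / 4), mem_nhdsWithin_of_mem_nhds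
        (Metric.ball_mem_nhds x (by positivity)), fun z => 1 - b z, contDiff_const.sub hb, ?_,
        fun f => ?_⟩
      · rw [eventually_nhdsSet_iff_exists]
        refine ⟨Metric.ball x (r / 2), Metric.isOpen_ball, Metric.ball_subset_ball (by linarith),
          fun z hz => ?_⟩
        change 1 - b z = 0
        rw [b.one_of_mem_closedBall (Metric.ball_subset_closedBall hz), sub_self]
      · have h1 : T (Ck.mulSmooth b hb f) y = 0 := by
          refine hWT _ fun z hz => ?_
          rw [Ck.mulSmooth_apply, b.zero_of_le_dist, zero_smul]
          by_contra hlt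
          exact hz (hrW (Metric.mem_closedBall.mpr (not_le.mp hlt).le))
        have h2 : f = Ck.mulSmooth (fun z => 1 - b z) (contDiff_const.sub hb) f +
            Ck.mulSmooth b hb f := by
          ext z
          simp [Ck.mulSmooth_apply, Ck.add_apply, sub_smul]
        conv_lhs => rw [h2, map_add, Ck.add_apply, h1, add_zero]
  obtain ⟨f, hf⟩ := hnt
  refine hf ?_
  rw [hχT, ← norm_le_zero_iff]
  refine (hC y rfl _ 0 le_rfl fun x hx j _ => ?_).trans (by simp)
  rw [D_eq_zero_of_eventually, norm_zero]
  rw [Ck.zeroExt_mulSmooth]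
  have := hχ0.filter_mono (nhds_le_nhdsSet hx)
  filter_upwards [this] with z hz
  rw [hz, zero_smul]

/-- `T f y` vanishes if `f` vanishes in a neighbourhood of a support point. -/
theorem IsSuppPt.map_eq_zero {T : Ck p X E →L[ℝ] Ck q Y F} (hsep : IsSeparating T) {y : Y} {x : X}
    (hx : IsSuppPt T y x) {f : Ck p X E}
    (hf : ∀ᶠ z in 𝓝 (x : G), zeroExt (X := (X : Set G)) f z = 0) : T f y = 0 := by
  -- The zero set of the extended `f` serves as the neighbourhood `W`, so `g` is disjoint from `f`.
  obtain ⟨g, hg, hgT⟩ := hx _ hf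
  refine (hsep f g (fun z => ?_) y).resolve_right hgT
  by_cases hz : zeroExt (X := (X : Set G)) f z = 0
  · left; rwa [Ck.zeroExt_coe] at hz
  · right; exact hg z hz

theorem continuous_emb : Continuous (emb p X) := by
  refine Continuous.subtype_mk (continuous_pi fun f => ?_) _
  exact OnePoint.continuous_coe.comp (Ck.continuous f)

/-- A point `z` other than the image of `h y` is separated from it by open sets. A small closed ball
around `h y` has compact, hence closed, image, so some `f` with `T f y ≠ 0` has its closed support
inside the open set around `h y`, excluding `z`. Conversely, `T f y ≠ 0` forces `h y` into the
closure of the set where `f` is nonzero. -/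
theorem isSupportMap_of_isSuppPt [FiniteDimensional ℝ G] {T : Ck p X E →L[ℝ] Ck q Y F}
    (hsep : IsSeparating T) {h : Y → X} (hh : ∀ y, IsSuppPt T y (h y)) : IsSupportMap T h := by
  intro y
  apply Subset.antisymm
  · intro z hz
    by_contra hne
    obtain ⟨U, W, hU, hW, hxU, hzW, hUW⟩ := t2_separation (Ne.symm hne : emb p X (h y) ≠ z)
    have hpre : emb p X ⁻¹' U ∈ 𝓝 (h y) := continuous_emb.continuousAt (hU.mem_nhds hxU)
    rw [nhds_subtype_eq_comap] at hpre
    obtain ⟨O, hO, hOU⟩ := hpre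
    obtain ⟨r, hr, hrO⟩ := Metric.nhds_basis_closedBall.mem_iff.mp
      (inter_mem hO (X.isOpen.mem_nhds (h y).2))
    obtain ⟨f, hf, hfT⟩ := hh y _ (Metric.closedBall_mem_nhds ((h y : X) : G) hr)
    let B : Set X := Subtype.val ⁻¹' Metric.closedBall ((h y : X) : G) r
    have hB : IsCompact B := by
      have : ProperSpace G := FiniteDimensional.proper ℝ G
      refine Topology.IsInducing.subtypeVal.isCompact_preimage'
        (isCompact_closedBall _ _) fun x hx => ?_
      rw [Subtype.range_coe]
      exact (hrO hx).2
    have hsub : suppClosure f ⊆ U := by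
      have h1 : suppClosure f ⊆ emb p X '' B := by
        refine closure_minimal (image_mono fun x hx => ?_) (hB.image continuous_emb).isClosed
        by_contra hxB
        exact hx (hf x hxB)
      refine h1.trans ?_
      rintro _ ⟨x, hx, rfl⟩
      exact hOU (hrO hx).1
    have hzU : z ∈ closure U := mem_iInter₂.mp hz U ⟨hU, f, hfT, hsub⟩
    obtain ⟨w, hwW, hwU⟩ := mem_closure_iff.mp hzU W hW hzW
    exact hUW.le_bot ⟨hwU, hwW⟩
  · rw [singleton_subset_iff, mem_iInter₂]
    rintro U ⟨-, f, hfT, hfU⟩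
    refine subset_closure (hfU ?_)
    have hcl : h y ∈ closure {x : X | f x ≠ 0} := by
      by_contra hn
      refine hfT ((hh y).map_eq_zero hsep ?_)
      rw [mem_closure_iff_nhds, not_forall] at hn
      obtain ⟨t, ht⟩ := hn
      rw [Classical.not_imp, not_nonempty_iff_eq_empty] at ht
      obtain ⟨ht, hte⟩ := ht
      rw [nhds_subtype_eq_comap] at ht
      obtain ⟨O, hO, hOt⟩ := ht
      filter_upwards [hO, X.isOpen.mem_nhds (h y).2] with z hzO hzX
      rw [Ck.zeroExt_coe f ⟨z, hzX⟩]
      by_contra hfz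
      have : (⟨z, hzX⟩ : X) ∈ t ∩ {x : X | f x ≠ 0} := ⟨hOt hzO, hfz⟩
      rw [hte] at this
      exact this
    exact image_closure_subset_closure_image continuous_emb (mem_image_of_mem _ hcl)

/-- If `f` lives in a closed `C` near `h y` and `T f y ≠ 0`, then `T f z ≠ 0` for `z` near `y`,
which puts `h z` in `C`. -/
theorem continuous_of_isSuppPt {T : Ck p X E →L[ℝ] Ck q Y F}
    (hsep : IsSeparating T) {h : Y → X} (hh : ∀ y, IsSuppPt T y (h y)) : Continuous h := by
  refine continuous_induced_rng.mpr (continuous_iff_continuousAt.mpr fun y W hW => ?_)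
  rw [mem_map]
  obtain ⟨C, hC, hCc, hCW⟩ := exists_mem_nhds_isClosed_subset hW
  obtain ⟨f, hf, hfT⟩ := hh y C hC
  have : ∀ᶠ z in 𝓝 y, T f z ≠ 0 := (T f).continuous.continuousAt.eventually_ne hfT
  filter_upwards [this] with z hz
  by_contra hzW
  refine hz ((hh z).map_eq_zero hsep ?_)
  have hzC : (h z : G) ∈ Cᶜ := fun hc => hzW (hCW hc)
  filter_upwards [hCc.isOpen_compl.mem_nhds hzC] with x hx
  by_cases hxX : x ∈ X
  · rw [Ck.zeroExt_coe f ⟨x, hxX⟩]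
    exact hf _ hx
  · exact zeroExt_of_notMem _ hxX

/-- Uniformly for `y` in a compact set, `T f y` vanishes if the derivatives of `f` at the support
point vanish up to some order. -/
theorem exists_order_on_compact [FiniteDimensional ℝ G] {T : Ck p X E →L[ℝ] Ck q Y F}
    (hsep : IsSeparating T) {h : Y → X} (hh : ∀ y, IsSuppPt T y (h y)) {L : Set H}
    (hL : IsCompact L) (hLY : L ⊆ Y) :
    ∃ N : ℕ, (N : ℕ∞) ≤ p ∧ ∀ y : Y, (y : H) ∈ L → ∀ f : Ck p X E,
      VanishesTo (N + 1) (zeroExt (X := (X : Set G)) f) (h y) → T f y = 0 := by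
  obtain ⟨K, hK, hKX, N, hN, C, hC0, hC⟩ := exists_bound_on_compact T hL hLY
  refine ⟨N, hN, fun y hy f hf => ?_⟩
  -- Cutting `f` off near `h y` does not change `T f y`, but makes the controlling derivatives as
  -- small as desired.
  have hle : ∀ δ > 0, ‖T f y‖ ≤ C * δ := by
    intro δ hδ
    obtain ⟨χ, hχ, h1, hs⟩ := exists_cutoff_small
      ((f.contDiffAt (h y).2).of_le (by exact_mod_cast hN)) hf hδ
    have e : T f y = T (Ck.mulSmooth χ hχ f) y := by
      rw [← sub_eq_zero, ← Ck.sub_apply, ← map_sub]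
      refine (hh y).map_eq_zero hsep ?_
      filter_upwards [h1, X.isOpen.mem_nhds (h y).2] with z hz hzX
      rw [Ck.zeroExt_coe (f - Ck.mulSmooth χ hχ f) ⟨z, hzX⟩, Ck.sub_apply, Ck.mulSmooth_apply]
      simp [hz]
    rw [e]
    refine hC y hy _ δ hδ.le fun x _ j hj => ?_
    unfold Ck.D
    rw [Ck.zeroExt_mulSmooth]
    exact hs x j hj
  rw [← norm_le_zero_iff]
  refine le_of_forall_pos_le_add fun ε hε => ?_
  refine (hle (ε / (C + 1)) (by positivity)).trans ?_
  rw [zero_add, mul_div_assoc', div_le_iff₀ (by positivity)]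
  nlinarith

/-- The order of the functionals `f ↦ T f y` is locally bounded in `y`. -/
theorem exists_order_near [FiniteDimensional ℝ G] {T : Ck p X E →L[ℝ] Ck q Y F}
    (hsep : IsSeparating T) {h : Y → X} (hh : ∀ y, IsSuppPt T y (h y)) (y₀ : Y) :
    ∃ N : ℕ, (N : ℕ∞) ≤ p ∧ ∀ᶠ y in 𝓝 y₀, ∀ f : Ck p X E,
      VanishesTo (N + 1) (zeroExt (X := (X : Set G)) f) (h y) → T f y = 0 := by
  by_contra! hno
  -- `H` may lack compact neighbourhoods, so one argues along a sequence `y k → y₀` where `y k`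
  -- defeats all orders up to `min k p`. The sequence with its limit is compact, and the uniform
  -- order `N` on it contradicts the choice of `y N`.
  have hex : ∀ k : ℕ, ∃ y : Y, dist y y₀ < 1 / ((k : ℝ) + 1) ∧ ∀ N : ℕ, (N : ℕ∞) ≤ p → N ≤ k →
      ∃ f : Ck p X E, VanishesTo (N + 1) (zeroExt (X := (X : Set G)) f) (h y) ∧ T f y ≠ 0 := by
    intro k
    obtain ⟨M, hMp, hM⟩ : ∃ M : ℕ, (M : ℕ∞) ≤ p ∧ ∀ N : ℕ, (N : ℕ∞) ≤ p → N ≤ k → N ≤ M := by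
      by_cases hk : (k : ℕ∞) ≤ p
      · exact ⟨k, hk, fun N _ h => h⟩
      · obtain ⟨m, rfl⟩ := ENat.ne_top_iff_exists.mp (ne_top_of_lt (not_le.mp hk))
        exact ⟨m, le_rfl, fun N h _ => by exact_mod_cast h⟩
    have h1 : {y | dist y y₀ < 1 / ((k : ℝ) + 1)} ∈ 𝓝 y₀ :=
      Metric.ball_mem_nhds y₀ (by positivity)
    have h2 := hno M hMp
    obtain ⟨y, ⟨f, hf, hfT⟩, hyd⟩ := (h2.and_eventually h1).exists
    exact ⟨y, hyd, fun N hN hNk => ⟨f, fun j hj => hf j (by have := hM N hN hNk; omega), hfT⟩⟩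
  choose y hyd hy using hex
  have hlim : Tendsto y atTop (𝓝 y₀) := by
    rw [tendsto_iff_dist_tendsto_zero]
    exact squeeze_zero (fun _ => dist_nonneg) (fun k => (hyd k).le)
      tendsto_one_div_add_atTop_nhds_zero_nat
  have hcomp := (hlim.isCompact_insert_range).image continuous_subtype_val
  obtain ⟨N, hN, hNT⟩ := exists_order_on_compact hsep hh hcomp (by
    rintro _ ⟨z, -, rfl⟩; exact z.2)
  obtain ⟨f, hf, hfT⟩ := hy N N hN le_rfl
  exact hfT (hNT (y N) ⟨y N, mem_insert_of_mem _ (mem_range_self N), rfl⟩ f hf)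

end Support

/-! ### Recovering a point from the moments of a functional concentrated there -/

section Hankel

open Polynomial

/-- The Hankel matrix of the moments of a linear functional on polynomials. -/
def hankel (L : ℝ[X] →ₗ[ℝ] ℝ) (M : ℕ) : Matrix (Fin (M + 1)) (Fin (M + 1)) ℝ :=
  Matrix.of fun a b => L (X ^ ((a : ℕ) + b))

/-- A kernel vector is a polynomial `P ≠ 0` of degree at most `M` with `L (Q * P) = 0` whenever `Q`
has degree at most `M`. Write `P = (X - c)^r R` with `R(c) ≠ 0`; then `Q = (X - c)^(M - r)` gives
`R(c) L((X - c)^M) = 0`, a contradiction. -/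
theorem det_hankel_ne_zero {L : ℝ[X] →ₗ[ℝ] ℝ} {M : ℕ} {c : ℝ}
    (h0 : ∀ P, L ((X - C c) ^ (M + 1) * P) = 0) (h1 : L ((X - C c) ^ M) ≠ 0) :
    (hankel L M).det ≠ 0 := by
  rw [Ne, ← Matrix.exists_mulVec_eq_zero_iff]
  rintro ⟨v, hv, hAv⟩
  set P : ℝ[X] := ∑ b : Fin (M + 1), Polynomial.C (v b) * X ^ (b : ℕ) with hP
  have hcoeff : ∀ b : Fin (M + 1), P.coeff b = v b := by
    intro b
    simp only [hP, finsetSum_coeff, coeff_C_mul, coeff_X_pow]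
    rw [Finset.sum_eq_single b]
    · simp
    · intro d _ hd
      have : (b : ℕ) ≠ d := fun h => hd (Fin.ext h.symm)
      simp [this]
    · simp
  have hP0 : P ≠ 0 := by
    intro h
    apply hv
    funext b
    rw [← hcoeff b, h]; simp
  have hdeg : P.natDegree ≤ M := natDegree_sum_le_of_forall_le _ _ fun b _ =>
    (natDegree_C_mul_X_pow_le _ _).trans (Nat.lt_succ_iff.mp b.2)
  have hmon : ∀ a : ℕ, a ≤ M → L (X ^ a * P) = 0 := by
    intro a ha
    have := congrFun hAv ⟨a, Nat.lt_succ_of_le ha⟩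
    simp only [Matrix.mulVec, dotProduct, hankel, Matrix.of_apply, Pi.zero_apply] at this
    rw [hP, Finset.mul_sum, map_sum, ← this]
    refine Finset.sum_congr rfl fun b _ => ?_
    rw [show X ^ a * (Polynomial.C (v b) * X ^ (b : ℕ)) = v b • (X ^ (a + (b : ℕ)) : ℝ[X]) by
      rw [smul_eq_C_mul, pow_add]; ring, map_smul, smul_eq_mul, mul_comm]
  have hpol : ∀ Q : ℝ[X], Q.natDegree ≤ M → L (Q * P) = 0 := by
    intro Q hQ
    conv_lhs => rw [Q.as_sum_range' (M + 1) (Nat.lt_succ_of_le hQ)]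
    rw [Finset.sum_mul, map_sum]
    refine Finset.sum_eq_zero fun a ha => ?_
    rw [← C_mul_X_pow_eq_monomial, mul_assoc, ← smul_eq_C_mul, map_smul,
      hmon a (Nat.lt_succ_iff.mp (Finset.mem_range.mp ha)), smul_zero]
  obtain ⟨R, hR, hndvd⟩ := exists_eq_pow_rootMultiplicity_mul_and_not_dvd P hP0 c
  set r := rootMultiplicity c P
  have hr : r ≤ M := by
    have hle := natDegree_le_of_dvd (Dvd.intro R hR.symm) hP0
    rw [natDegree_pow, natDegree_X_sub_C] at hle
    omega
  have hRc : R.eval c ≠ 0 := fun h => hndvd (dvd_iff_isRoot.mpr h)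
  obtain ⟨S, hS⟩ : X - Polynomial.C c ∣ R - Polynomial.C (R.eval c) := by
    rw [dvd_iff_isRoot]; simp
  have := hpol ((X - Polynomial.C c) ^ (M - r)) (by
    rw [natDegree_pow, natDegree_X_sub_C]; omega)
  rw [hR, ← mul_assoc, ← pow_add, Nat.sub_add_cancel hr, eq_add_of_sub_eq hS, mul_add,
    ← mul_assoc, ← pow_succ, map_add, h0, zero_add, mul_comm, ← smul_eq_C_mul, map_smul] at this
  exact smul_ne_zero hRc h1 this

/-- The relations `L(X^a (X - c)^(M+1)) = 0` form a linear system with the Hankel matrix, solved by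
the negated lower coefficients of `(X - c)^(M+1)`. The last of these is `(M + 1) c`, and Cramer's
rule isolates it. -/
theorem det_hankel_mul {L : ℝ[X] →ₗ[ℝ] ℝ} {M : ℕ} {c : ℝ}
    (h0 : ∀ P, L ((X - C c) ^ (M + 1) * P) = 0) :
    (hankel L M).det * ((M + 1) * c) =
      (hankel L M).cramer (fun a : Fin (M + 1) => L (X ^ ((a : ℕ) + (M + 1)))) (Fin.last M) := by
  set v : Fin (M + 1) → ℝ := fun j => -((X - C c) ^ (M + 1)).coeff j with hv
  have hAv : (hankel L M).mulVec v = fun a : Fin (M + 1) => L (X ^ ((a : ℕ) + (M + 1))) := by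
    funext a
    have hmonic : ((X - C c) ^ (M + 1)).coeff (M + 1) = 1 := by
      have := (monic_X_sub_C c).pow (M + 1)
      rwa [Monic, leadingCoeff, natDegree_pow, natDegree_X_sub_C, mul_one] at this
    have h := h0 (X ^ (a : ℕ))
    have hsum := ((X - C c : ℝ[X]) ^ (M + 1)).as_sum_range' (M + 2) (by
      rw [natDegree_pow, natDegree_X_sub_C]; omega)
    rw [hsum, Finset.sum_range_succ, hmonic, add_mul,
      map_add, Finset.sum_mul, map_sum, Finset.sum_range] at h
    rw [show (monomial (M + 1) (1 : ℝ)) * X ^ (a : ℕ) = X ^ ((a : ℕ) + (M + 1)) by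
      rw [← C_mul_X_pow_eq_monomial, pow_add, C_1]; ring] at h
    simp only [Matrix.mulVec, dotProduct, hankel, Matrix.of_apply]
    rw [← sub_eq_zero, ← neg_eq_zero, ← h, neg_sub, sub_eq_add_neg, add_comm,
      ← Finset.sum_neg_distrib]
    congr 1
    refine Finset.sum_congr rfl fun j _ => ?_
    have hmono : ∀ (k : ℕ) (t : ℝ), L (monomial k t * X ^ (a : ℕ)) = t * L (X ^ ((a : ℕ) + k)) := by
      intro k t
      rw [← C_mul_X_pow_eq_monomial, mul_assoc, ← smul_eq_C_mul, map_smul, smul_eq_mul, pow_add,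
        mul_comm (X ^ k)]
    rw [hmono]
    simp only [hv]; ring
  have hlast : v (Fin.last M) = (M + 1) * c := by
    simp only [hv, Fin.val_last]
    rw [sub_eq_add_neg, ← C_neg, coeff_X_add_C_pow]
    simp [mul_comm]
  rw [← hAv, Matrix.cramer_eq_adjugate_mulVec, Matrix.mulVec_mulVec, Matrix.adjugate_mul,
    Matrix.smul_mulVec, Matrix.one_mulVec, Pi.smul_apply, hlast, smul_eq_mul]

end Hankel

/-! ### The operator on polynomials and its coefficients -/

section Polynomials

variable {n : ℕ} {E : Type*} [NormedAddCommGroup E] [NormedSpace ℝ E]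
variable {H : Type*} [NormedAddCommGroup H] [NormedSpace ℝ H]
variable {F : Type*} [NormedAddCommGroup F] [NormedSpace ℝ F]
variable {p q : ℕ∞} {X : Opens (EuclideanSpace ℝ (Fin n))} {Y : Opens H}

open MvPolynomial

theorem contDiff_eval (Q : MvPolynomial (Fin n) ℝ) (m : WithTop ℕ∞) :
    ContDiff ℝ m fun x : EuclideanSpace ℝ (Fin n) => eval x.ofLp Q := by
  induction Q using MvPolynomial.induction_on with
  | C a => simpa using contDiff_const
  | add P Q hP hQ => simpa using hP.add hQ
  | mul_X P i hP => simpa using hP.mul (EuclideanSpace.proj (𝕜 := ℝ) i).contDiff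

/-- Evaluation at a point, as a linear map on `C^p(X, E)`. -/
def Ck.evalₗ {G : Type*} [NormedAddCommGroup G] [NormedSpace ℝ G] {X : Opens G} (x : X) :
    Ck p X E →ₗ[ℝ] E where
  toFun f := f x
  map_add' f g := Ck.add_apply f g x
  map_smul' c f := Ck.smul_apply c f x

/-- The function `x ↦ Q(x) u` on `X`, for a polynomial `Q`. -/
def polyFun (p : ℕ∞) (X : Opens (EuclideanSpace ℝ (Fin n))) (u : E) :
    MvPolynomial (Fin n) ℝ →ₗ[ℝ] Ck p X E where
  toFun Q := ⟨fun x => eval (x : EuclideanSpace ℝ (Fin n)).ofLp Q • u,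
    ((contDiff_eval Q p).smul contDiff_const).contDiffOn.congr fun x hx =>
      zeroExt_apply (X := (X : Set (EuclideanSpace ℝ (Fin n)))) _ ⟨x, hx⟩⟩
  map_add' P Q := Ck.ext fun x => by
    change eval (x : EuclideanSpace ℝ (Fin n)).ofLp (P + Q) • u =
      eval (x : EuclideanSpace ℝ (Fin n)).ofLp P • u +
        eval (x : EuclideanSpace ℝ (Fin n)).ofLp Q • u
    rw [map_add, add_smul]
  map_smul' c Q := Ck.ext fun x => by
    change eval (x : EuclideanSpace ℝ (Fin n)).ofLp (c • Q) • u =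
      c • eval (x : EuclideanSpace ℝ (Fin n)).ofLp Q • u
    rw [smul_eval, mul_smul]

theorem polyFun_apply (u : E) (Q : MvPolynomial (Fin n) ℝ) (x : X) :
    polyFun p X u Q x = eval (x : EuclideanSpace ℝ (Fin n)).ofLp Q • u := rfl

theorem zeroExt_polyFun_eventuallyEq (u : E) (Q : MvPolynomial (Fin n) ℝ)
    {a : EuclideanSpace ℝ (Fin n)} (ha : a ∈ X) :
    (fun x : EuclideanSpace ℝ (Fin n) => eval x.ofLp Q • u) =ᶠ[𝓝 a]
      zeroExt (X := (X : Set (EuclideanSpace ℝ (Fin n)))) (polyFun p X u Q) := by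
  filter_upwards [X.isOpen.mem_nhds ha] with x hx
  rw [Ck.zeroExt_coe (polyFun p X u Q) ⟨x, hx⟩, polyFun_apply]

/-- The substitution `Q(x) ↦ Q(x - b)`. -/
def shift (b : EuclideanSpace ℝ (Fin n)) : MvPolynomial (Fin n) ℝ →ₐ[ℝ] MvPolynomial (Fin n) ℝ :=
  aeval fun i => MvPolynomial.X i - C (b i)

@[simp] theorem shift_X (b : EuclideanSpace ℝ (Fin n)) (i : Fin n) :
    shift b (MvPolynomial.X i) = MvPolynomial.X i - C (b i) := aeval_X _ _

theorem shift_shift_neg (b : EuclideanSpace ℝ (Fin n)) (Q : MvPolynomial (Fin n) ℝ) :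
    shift b (shift (-b) Q) = Q := by
  have : (shift b).comp (shift (-b)) = AlgHom.id ℝ _ := by
    ext i : 1
    simp [shift, algebraMap_eq]
  exact DFunLike.congr_fun this Q

theorem eval_shift (b : EuclideanSpace ℝ (Fin n)) (Q : MvPolynomial (Fin n) ℝ)
    (x : EuclideanSpace ℝ (Fin n)) : eval x.ofLp (shift b Q) = eval (x - b).ofLp Q := by
  induction Q using MvPolynomial.induction_on with
  | C a => simp [shift]
  | add P Q hP hQ => simp [hP, hQ]
  | mul_X P i hP => simp [hP]

theorem shift_monomial (b : EuclideanSpace ℝ (Fin n)) (s : Fin n →₀ ℕ) (c : ℝ) :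
    shift b (monomial s c) = C c * ∏ i, (MvPolynomial.X i - C (b i)) ^ s i := by
  rw [monomial_eq, map_mul, Finsupp.prod_fintype _ _ (by simp), map_prod]
  simp [shift]

/-- The coefficients of `T` are, up to normalization, the values of `T` on the monomials centred
at the support point. -/
theorem Phi_symMono (T : Ck p X E →L[ℝ] Ck q Y F) (h : Y → X) (y : Y) (s : Fin n →₀ ℕ) (u : E) :
    Phi T h (order s) y (symMono s u) =
      ((order s)! : ℝ)⁻¹ • T (polyFun p X u (shift (h y) (monomial s 1))) y := by
  unfold Phi
  congr 1
  refine congrArg (fun g => T g y) (Ck.ext fun x => ?_)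
  change (symMono s u).1 (fun _ => (x : EuclideanSpace ℝ (Fin n)) - h y) = _
  rw [symMono_diag, polyFun_apply, shift_monomial]
  simp

theorem Phi_symMono_eq_zero_iff (T : Ck p X E →L[ℝ] Ck q Y F) (h : Y → X) (y : Y)
    (s : Fin n →₀ ℕ) (u : E) :
    Phi T h (order s) y (symMono s u) = 0 ↔
      T (polyFun p X u (shift (h y) (monomial s 1))) y = 0 := by
  rw [Phi_symMono, smul_eq_zero, or_iff_right]
  positivity

/-- The monomial is a product of `order s` linear factors, each vanishing at `b`. -/
theorem vanishesTo_monomial (s : Fin n →₀ ℕ) (u : E) (b : EuclideanSpace ℝ (Fin n)) :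
    VanishesTo (order s)
      (fun x : EuclideanSpace ℝ (Fin n) => eval x.ofLp (shift b (monomial s 1)) • u) b := by
  have hlin : ∀ i, ContDiff ℝ (⊤ : ℕ∞) fun x : EuclideanSpace ℝ (Fin n) => x i - b i := fun i =>
    (EuclideanSpace.proj (𝕜 := ℝ) i).contDiff.sub contDiff_const
  have hpow : ∀ (i : Fin n) (m : ℕ),
      VanishesTo m (fun x : EuclideanSpace ℝ (Fin n) => (x i - b i) ^ m) b := by
    intro i m
    induction m with
    | zero => intro j hj; omega
    | succ m ih =>
      have := VanishesTo.smul (χ := fun x : EuclideanSpace ℝ (Fin n) => (x i - b i) ^ m)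
        (f := fun x : EuclideanSpace ℝ (Fin n) => x i - b i) (k := m) (l := 1)
        (((hlin i).pow m).of_le (by exact_mod_cast le_top))
        ((hlin i).of_le (by exact_mod_cast le_top)) ih
        (vanishesTo_one_sub (EuclideanSpace.proj (𝕜 := ℝ) i) b)
      simpa [pow_succ] using this
  have hprod : ∀ S : Finset (Fin n), VanishesTo (∑ i ∈ S, s i)
      (fun x : EuclideanSpace ℝ (Fin n) => ∏ i ∈ S, (x i - b i) ^ s i) b := by
    intro S
    induction S using Finset.induction_on with
    | empty => intro j hj; simp at hj
    | insert i S hi ih =>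
      rw [Finset.sum_insert hi]
      simp only [Finset.prod_insert hi]
      exact VanishesTo.smul (((hlin i).pow _).of_le (by exact_mod_cast le_top))
        ((contDiff_prod fun i _ => (hlin i).pow _).of_le (by exact_mod_cast le_top)) (hpow i _) ih
  have := VanishesTo.smul (l := 0) (f := fun _ => u)
    ((contDiff_prod fun i _ => (hlin i).pow _).of_le (by exact_mod_cast le_top)) contDiff_const
    (hprod Finset.univ) (fun j hj => by omega)
  simpa [shift_monomial] using this

/-- The functional `f ↦ T f y` has order at most `N ≤ p` at the support point `h y`. -/
def HasOrderLE (T : Ck p X E →L[ℝ] Ck q Y F) (h : Y → X) (y : Y) (N : ℕ) : Prop :=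
  (N : ℕ∞) ≤ p ∧ ∀ f : Ck p X E,
    VanishesTo (N + 1) (zeroExt (X := (X : Set (EuclideanSpace ℝ (Fin n)))) f) (h y) → T f y = 0

theorem HasOrderLE.map_monomial_eq_zero {T : Ck p X E →L[ℝ] Ck q Y F} {h : Y → X} {y : Y} {N : ℕ}
    (hN : HasOrderLE T h y N) {s : Fin n →₀ ℕ} (hs : N < order s) (u : E) :
    T (polyFun p X u (shift (h y) (monomial s 1))) y = 0 := by
  refine hN.2 _ (VanishesTo.congr ?_ (zeroExt_polyFun_eventuallyEq u _ (h y).2))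
  exact fun j hj => vanishesTo_monomial s u _ j (by omega)

/-- If all coefficients belonging to multiindices with `i`-th entry greater than `M` vanish at `y`,
then `T` kills all polynomials divisible by `(x_i - h_i(y))^(M + 1)` at `y`. -/
theorem HasOrderLE.map_pow_mul_eq_zero {T : Ck p X E →L[ℝ] Ck q Y F} {h : Y → X} {y : Y} {N : ℕ}
    (hN : HasOrderLE T h y N) {i : Fin n} {M : ℕ}
    (hM : ∀ u : E, ∀ l : Fin n → ℕ, (order l : ℕ∞) ≤ p → M < l i →
      Phi T h (order l) y (symMono l u) = 0) (u : E) (R : MvPolynomial (Fin n) ℝ) :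
    T (polyFun p X u ((MvPolynomial.X i - C ((h y : EuclideanSpace ℝ (Fin n)) i)) ^ (M + 1) * R))
      y = 0 := by
  -- Recentring `R` at `h y` reduces the claim to centred monomials whose `i`-th exponent exceeds
  -- `M`.
  rw [← shift_shift_neg (h y) R, ← shift_X, ← map_pow, ← map_mul]
  generalize shift (-(h y : EuclideanSpace ℝ (Fin n))) R = Q
  induction Q using MvPolynomial.induction_on' with
  | add P Q hP hQ => rw [mul_add, map_add, map_add, map_add, Ck.add_apply, hP, hQ, add_zero]
  | monomial s a =>
    rw [X_pow_eq_monomial, monomial_mul, one_mul, ← mul_one a, ← smul_eq_mul, ← smul_monomial,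
      map_smul, map_smul, map_smul, Ck.smul_apply]
    set t := Finsupp.single i (M + 1) + s
    have hti : M < t i := by simp [t]; omega
    suffices h0 : T (polyFun p X u (shift (h y) (monomial t 1))) y = 0 by rw [h0, smul_zero]
    -- The hypothesis on the coefficients covers only orders at most `p`; orders above `N` are
    -- killed by the order bound instead.
    by_cases ht : order t ≤ N
    · rw [← Phi_symMono_eq_zero_iff]
      exact hM u t (le_trans (by exact_mod_cast ht) hN.1) hti
    · exact hN.map_monomial_eq_zero (not_le.mp ht) u

/-- Splits the homogeneous Taylor polynomial into vector multiples of monomials, on which the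
coefficients of `T` can be read off. -/
theorem multilinear_diag_eq_sum {k : ℕ}
    (A : ContinuousMultilinearMap ℝ (fun _ : Fin k => EuclideanSpace ℝ (Fin n)) E)
    (v : EuclideanSpace ℝ (Fin n)) :
    A (fun _ => v) = ∑ c : Fin k → Fin n, (∏ j, v (c j)) •
      A fun j => EuclideanSpace.basisFun (Fin n) ℝ (c j) := by
  conv_lhs => rw [← (EuclideanSpace.basisFun (Fin n) ℝ).sum_repr v]
  rw [ContinuousMultilinearMap.map_sum]
  simp [ContinuousMultilinearMap.map_smul_univ]

/-- At least one of the coefficients of `T` at `y` does not vanish. -/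
theorem HasOrderLE.exists_Phi_ne_zero {T : Ck p X E →L[ℝ] Ck q Y F} {h : Y → X} {y : Y} {N : ℕ}
    (hN : HasOrderLE T h y N) (hnt : ∃ f : Ck p X E, T f y ≠ 0) :
    ∃ (l : Fin n → ℕ) (u : E), (order l : ℕ∞) ≤ p ∧ Phi T h (order l) y (symMono l u) ≠ 0 := by
  by_contra! hno
  obtain ⟨f, hf⟩ := hnt
  -- If all coefficients vanish, `T` kills every homogeneous Taylor polynomial of degree at most
  -- `N`. Subtracting these lowers the required order of vanishing one by one, until at `k = N + 1`
  -- nothing is required of `f`.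
  have key : ∀ k ≤ N + 1, ∀ f : Ck p X E,
      VanishesTo (N + 1 - k) (zeroExt (X := (X : Set (EuclideanSpace ℝ (Fin n)))) f) (h y) →
        T f y = 0 := by
    intro k
    induction k with
    | zero => intro _ f hf; exact hN.2 f hf
    | succ k ih =>
      intro hk f hf
      set m := N + 1 - (k + 1) with hm
      have hmp : (m : ℕ∞) ≤ p := le_trans (by exact_mod_cast (by omega)) hN.1
      set A := iteratedFDeriv ℝ m (zeroExt (X := (X : Set (EuclideanSpace ℝ (Fin n)))) f) (h y)
        with hA
      have htay := VanishesTo.sub_taylor ((f.contDiffAt (h y).2).of_le (by exact_mod_cast hmp)) hf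
      -- `s c` counts how often each coordinate occurs in `c`.
      let s : (Fin m → Fin n) → (Fin n →₀ ℕ) := fun c => ∑ j, Finsupp.single (c j) 1
      let g : Ck p X E := (m ! : ℝ)⁻¹ • ∑ c : Fin m → Fin n,
        polyFun p X (A fun j => EuclideanSpace.basisFun (Fin n) ℝ (c j))
          (shift (h y) (monomial (s c) 1))
      have hs : ∀ c, order (s c) = m := fun c => by
        change ∑ i, s c i = m
        simp only [s, Finsupp.finsetSum_apply]
        rw [Finset.sum_comm]
        simp [Finsupp.single_apply]
      have hg : T g y = 0 := by
        change ((Ck.evalₗ y).comp T.toLinearMap) g = 0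
        rw [map_smul, map_sum, Finset.sum_eq_zero, smul_zero]
        intro c _
        exact (Phi_symMono_eq_zero_iff T h y (s c) _).mp (hno _ _ (by rw [hs]; exact hmp))
      have hfg : T (f - g) y = 0 := by
        refine ih (by omega) _ ?_
        rw [show N + 1 - k = m + 1 by omega]
        refine htay.congr ?_
        filter_upwards [X.isOpen.mem_nhds (h y).2] with x hx
        rw [Ck.zeroExt_coe (f - g) ⟨x, hx⟩, Ck.sub_apply, Ck.zeroExt_coe f ⟨x, hx⟩]
        congr 1
        change _ = Ck.evalₗ (⟨x, hx⟩ : X) g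
        rw [map_smul, map_sum, ← hA, multilinear_diag_eq_sum]
        congr 1
        refine Finset.sum_congr rfl fun c _ => ?_
        refine Eq.trans ?_ (polyFun_apply (p := p) (X := X) _ _ ⟨x, hx⟩).symm
        rw [eval_shift, monomial_sum_one, map_prod]
        congr 1
        exact Finset.prod_congr rfl fun j _ => (eval_X (c j)).symm
      rw [map_sub, Ck.sub_apply, hg, sub_zero] at hfg
      exact hfg
  exact hf (key (N + 1) le_rfl f fun j hj => by omega)

/-- The argument of `T` itself moves with `y`, but only through coordinates of `h y`. The extra
fixed factor `R` makes the induction work: in `x_i - h_i(y)` the variable is absorbed into `R` and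
the continuous scalar `h_i(y)` is pulled out. -/
theorem continuous_map_polyFun_shift (T : Ck p X E →L[ℝ] Ck q Y F) {h : Y → X} (hc : Continuous h)
    (u : E) (Q : MvPolynomial (Fin n) ℝ) :
    Continuous fun y => T (polyFun p X u (shift (h y) Q)) y := by
  suffices ∀ R, Continuous fun y => T (polyFun p X u (R * shift (h y) Q)) y by
    simpa using this 1
  induction Q using MvPolynomial.induction_on with
  | C a =>
    intro R
    simpa [shift] using (T (polyFun p X u (R * algebraMap ℝ _ a))).continuous
  | add P Q hP hQ =>
    intro R
    refine ((hP R).add (hQ R)).congr fun y => ?_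
    rw [map_add, mul_add, map_add, map_add, Ck.add_apply]
    rfl
  | mul_X P i hP =>
    intro R
    have hi : Continuous fun y => (h y : EuclideanSpace ℝ (Fin n)) i :=
      (EuclideanSpace.proj (𝕜 := ℝ) i).continuous.comp (continuous_subtype_val.comp hc)
    refine ((hP (R * MvPolynomial.X i)).sub (hi.smul (hP R))).congr fun y => ?_
    have e : R * shift (h y) (P * MvPolynomial.X i) = R * MvPolynomial.X i * shift (h y) P -
        (h y : EuclideanSpace ℝ (Fin n)) i • (R * shift (h y) P) := by
      rw [map_mul, shift_X, smul_eq_C_mul]; ring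
    rw [e, map_sub, map_sub, map_smul, map_smul, Ck.sub_apply, Ck.smul_apply]
    rfl

end Polynomials

/-! ### Openness and density of the good sets, regularity of the support map -/

section Main

variable {n : ℕ} {E : Type*} [NormedAddCommGroup E] [NormedSpace ℝ E]
variable {H : Type*} [NormedAddCommGroup H] [NormedSpace ℝ H]
variable {F : Type*} [NormedAddCommGroup F] [NormedSpace ℝ F]
variable {p q : ℕ∞} {X : Opens (EuclideanSpace ℝ (Fin n))} {Y : Opens H}

theorem Phi_eq_zero_iff (T : Ck p X E →L[ℝ] Ck q Y F) (h : Y → X) (y : Y)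
    (l : Fin n → ℕ) (u : E) :
    Phi T h (order l) y (symMono l u) = 0 ↔
      T (polyFun p X u (shift (h y) (MvPolynomial.monomial (Finsupp.equivFunOnFinite.symm l) 1))) y
        = 0 :=
  Phi_symMono_eq_zero_iff T h y (Finsupp.equivFunOnFinite.symm l) u

theorem isOpen_goodSet (T : Ck p X E →L[ℝ] Ck q Y F) {h : Y → X} (hc : Continuous h) (i : Fin n) :
    IsOpen (goodSet T h i) := by
  rw [isOpen_iff_mem_nhds]
  rintro y₀ ⟨M, V, hV, hyV, hvan, l, u, hl, hli, hne⟩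
  have hev := (continuous_map_polyFun_shift T hc u
    (MvPolynomial.monomial (Finsupp.equivFunOnFinite.symm l) 1)).continuousAt.eventually_ne
      (mt (Phi_eq_zero_iff T h y₀ l u).mpr hne)
  filter_upwards [hV.mem_nhds hyV, hev] with y hy hy'
  exact ⟨M, V, hV, hy, hvan, l, u, hl, hli, mt (Phi_eq_zero_iff T h y l u).mp hy'⟩

theorem eventually_hasOrderLE {T : Ck p X E →L[ℝ] Ck q Y F} (hsep : IsSeparating T) {h : Y → X}
    (hh : ∀ y, IsSuppPt T y (h y)) (y₀ : Y) : ∃ N : ℕ, ∀ᶠ y in 𝓝 y₀, HasOrderLE T h y N := by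
  obtain ⟨N, hN, hev⟩ := exists_order_near hsep hh y₀
  exact ⟨N, hev.mono fun y hy => ⟨hN, hy⟩⟩

/-- Take the least `M` such that the coefficients with `l i > M` vanish on some nonempty open `W ⊆
V`. If `V` missed the good set, those with `l i = M` would vanish on `W` too: for `M > 0` this
contradicts minimality, for `M = 0` it makes all coefficients vanish, against nowhere triviality. -/
theorem dense_goodSet {T : Ck p X E →L[ℝ] Ck q Y F} (hsep : IsSeparating T)
    (hnt : IsNowhereTrivial T) {h : Y → X} (hh : ∀ y, IsSuppPt T y (h y)) (i : Fin n) :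
    Dense (goodSet T h i) := by
  classical
  rw [dense_iff_inter_open]
  rintro V hV ⟨y₀, hy₀⟩
  have hex : ∃ m : ℕ, ∃ W ⊆ V, IsOpen W ∧ W.Nonempty ∧ ∀ y ∈ W, ∀ u : E, ∀ l : Fin n → ℕ,
      (order l : ℕ∞) ≤ p → m < l i → Phi T h (order l) y (symMono l u) = 0 := by
    obtain ⟨N, hN⟩ := eventually_hasOrderLE hsep hh y₀
    obtain ⟨O, hO, hOo, hyO⟩ := mem_nhds_iff.mp hN
    refine ⟨N, V ∩ O, inter_subset_left, hV.inter hOo, ⟨y₀, hy₀, hyO⟩, fun y hy u l _ hli => ?_⟩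
    rw [Phi_eq_zero_iff]
    refine (hO hy.2).map_monomial_eq_zero ?_ u
    exact hli.trans_le (Finset.single_le_sum (f := l) (fun _ _ => Nat.zero_le _)
      (Finset.mem_univ i))
  obtain ⟨W, hWV, hW, ⟨y₁, hy₁⟩, hvan⟩ := Nat.find_spec hex
  set M := Nat.find hex
  by_contra hemp
  rw [not_nonempty_iff_eq_empty] at hemp
  have hall : ∀ y ∈ W, ∀ u : E, ∀ l : Fin n → ℕ, (order l : ℕ∞) ≤ p → l i = M →
      Phi T h (order l) y (symMono l u) = 0 := by
    intro y hy u l hl hli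
    by_contra hne
    have : y ∈ V ∩ goodSet T h i := ⟨hWV hy, M, W, hW, hy, hvan, l, u, hl, hli, hne⟩
    rw [hemp] at this
    exact this
  rcases Nat.eq_zero_or_pos M with hM | hM
  · obtain ⟨N, hN⟩ := eventually_hasOrderLE hsep hh y₁
    obtain ⟨l, u, hl, hne⟩ := hN.self_of_nhds.exists_Phi_ne_zero (hnt y₁)
    rcases Nat.eq_zero_or_pos (l i) with hli | hli
    · exact hne (hall y₁ hy₁ u l hl (hli.trans hM.symm))
    · exact hne (hvan y₁ hy₁ u l hl (hM ▸ hli))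
  · refine Nat.find_min hex (Nat.sub_lt hM one_pos)
      ⟨W, hWV, hW, ⟨y₁, hy₁⟩, fun y hy u l hl hli => ?_⟩
    rcases (show M ≤ l i by change M - 1 < l i at hli; omega).eq_or_lt with h1 | h1
    · exact hall y hy u l hl h1.symm
    · exact hvan y hy u l hl h1

theorem contDiffAt_det {m : ℕ} {k : WithTop ℕ∞} {A : H → Matrix (Fin m) (Fin m) ℝ} {z₀ : H}
    (hA : ∀ a b, ContDiffAt ℝ k (fun z => A z a b) z₀) :
    ContDiffAt ℝ k (fun z => (A z).det) z₀ := by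
  simp only [Matrix.det_apply']
  exact ContDiffAt.sum fun σ _ => contDiffAt_const.mul (contDiffAt_prod fun i _ => hA _ _)

-- The Hankel lemmas apply to `L y` with `c = h_i(y)`; near `y₀` the coordinate `h_i` is then a
-- quotient of determinants of `C^q` moments.
open Polynomial in
theorem contDiffAt_supportMap_coord {T : Ck p X E →L[ℝ] Ck q Y F} (hsep : IsSeparating T)
    {h : Y → X} (hh : ∀ y, IsSuppPt T y (h y)) {i : Fin n} {y₀ : Y} (hy₀ : y₀ ∈ goodSet T h i) :
    ContDiffAt ℝ q (zeroExt (X := (Y : Set H)) fun y => (h y : EuclideanSpace ℝ (Fin n)) i) y₀ := by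
  obtain ⟨M, V, hV, hyV, hvan, l, u, hl, rfl, hne⟩ := hy₀
  rw [Ne, Phi_eq_zero_iff] at hne
  set w := T (polyFun p X u (shift (h y₀)
    (MvPolynomial.monomial (Finsupp.equivFunOnFinite.symm l) 1))) y₀ with hw
  obtain ⟨ψ, -, hψ⟩ := exists_dual_vector ℝ w (norm_ne_zero_iff.mpr hne)
  set a : EuclideanSpace ℝ (Fin n) := (h y₀ : EuclideanSpace ℝ (Fin n)) with ha
  -- `R` is centred at the fixed point `h y₀`, not at `h y`: the functions fed to `T` must not
  -- depend on `y` for the moments to be `C^q`. The nonvanishing is needed at `y₀` only.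
  let R : MvPolynomial (Fin n) ℝ :=
    ∏ j ∈ Finset.univ.erase i, (MvPolynomial.X j - MvPolynomial.C (a j)) ^ l j
  let L : Y → ℝ[X] →ₗ[ℝ] ℝ := fun y => ψ.toLinearMap ∘ₗ Ck.evalₗ y ∘ₗ T.toLinearMap ∘ₗ
    polyFun p X u ∘ₗ LinearMap.mulRight ℝ R ∘ₗ
      (aeval (MvPolynomial.X i : MvPolynomial (Fin n) ℝ)).toLinearMap
  have hL : ∀ y P, L y P = ψ (T (polyFun p X u (aeval (MvPolynomial.X i) P * R)) y) :=
    fun y P => rfl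
  have hL1 : L y₀ ((Polynomial.X - C (a i)) ^ l i) ≠ 0 := by
    rw [hL]
    have e : aeval (MvPolynomial.X i : MvPolynomial (Fin n) ℝ) ((Polynomial.X - C (a i)) ^ l i) * R =
        shift a (MvPolynomial.monomial (Finsupp.equivFunOnFinite.symm l) 1) := by
      rw [shift_monomial, MvPolynomial.C_1, one_mul,
        ← Finset.mul_prod_erase Finset.univ _ (Finset.mem_univ i)]
      simp [R, MvPolynomial.algebraMap_eq]
    rw [e, ← hw, hψ]
    simpa using hne
  have hL0 : ∀ᶠ y in 𝓝 y₀, ∀ P, L y ((Polynomial.X - C ((h y : EuclideanSpace ℝ (Fin n)) i)) ^ (l i + 1) * P)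
      = 0 := by
    obtain ⟨N, hN⟩ := eventually_hasOrderLE hsep hh y₀
    filter_upwards [hN, hV.mem_nhds hyV] with y hy hyV P
    have h0 := hy.map_pow_mul_eq_zero (hvan y hyV) u (aeval (MvPolynomial.X i) P * R)
    rw [hL, map_mul (aeval _), mul_assoc, map_pow, map_sub, aeval_X, aeval_C,
      MvPolynomial.algebraMap_eq, h0, map_zero]
  let g : ℕ → H → ℝ := fun k z =>
    ψ (zeroExt (X := (Y : Set H)) (T (polyFun p X u (MvPolynomial.X i ^ k * R))) z)
  have hg : ∀ k, ContDiffAt ℝ q (g k) y₀ := fun k =>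
    ψ.contDiff.contDiffAt.comp _ ((T _).contDiffAt y₀.2)
  have hgL : ∀ k (y : Y), g k y = L y (Polynomial.X ^ k) := by
    intro k y
    rw [hL, map_pow, aeval_X]
    exact congrArg ψ (Ck.zeroExt_coe _ y)
  let A : H → Matrix (Fin (l i + 1)) (Fin (l i + 1)) ℝ := fun z =>
    Matrix.of fun a b => g ((a : ℕ) + b) z
  have hA : ∀ y : Y, A y = hankel (L y) (l i) := by
    intro y; ext a b; exact hgL _ y
  have hdet : ContDiffAt ℝ q (fun z => (A z).det) y₀ := contDiffAt_det fun a b => hg _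
  have hdet0 : (A y₀).det ≠ 0 := by
    rw [hA]; exact det_hankel_ne_zero hL0.self_of_nhds hL1
  -- The numerator in Cramer's rule for the last unknown, which is `(l i + 1) * h_i`.
  let B : H → ℝ := fun z =>
    ((A z).updateCol (Fin.last (l i)) fun a => g ((a : ℕ) + (l i + 1)) z).det
  have hB : ContDiffAt ℝ q B y₀ := by
    refine contDiffAt_det fun a b => ?_
    simp only [Matrix.updateCol_apply]
    split_ifs
    · exact hg _
    · exact hg _
  have hquot : ContDiffAt ℝ q (fun z => B z / ((A z).det * (l i + 1))) y₀ :=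
    hB.div (hdet.mul contDiffAt_const) (mul_ne_zero hdet0 (by positivity))
  refine hquot.congr_of_eventuallyEq ?_
  rw [nhds_subtype_eq_comap, eventually_comap] at hL0
  filter_upwards [hL0, Y.isOpen.mem_nhds y₀.2, hdet.continuousAt.eventually_ne hdet0]
    with z hz hzY hzd
  have h0 := det_hankel_mul (hz ⟨z, hzY⟩ rfl)
  rw [← hA, Matrix.cramer_apply] at h0
  simp only [← hgL] at h0
  rw [zeroExt_apply _ (⟨z, hzY⟩ : (Y : Set H)), eq_div_iff (mul_ne_zero hzd (by positivity))]
  change _ = ((A z).updateCol (Fin.last (l i)) fun a => g ((a : ℕ) + (l i + 1)) z).det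
  rw [← h0]
  ring

end Main

end SepMap

theorem proposition29 {n : ℕ}
    {H : Type*} [NormedAddCommGroup H] [NormedSpace ℝ H] [CompleteSpace H]
    {E : Type*} [NormedAddCommGroup E] [NormedSpace ℝ E] [CompleteSpace E]
    {F : Type*} [NormedAddCommGroup F] [NormedSpace ℝ F] [CompleteSpace F]
    (p q : ℕ∞) (hp : 1 ≤ p)
    (X : TopologicalSpace.Opens (EuclideanSpace ℝ (Fin n))) (Y : TopologicalSpace.Opens H)
    (T : SepMap.Ck p X E →L[ℝ] SepMap.Ck q Y F)
    (hsep : SepMap.IsSeparating T) (hnt : SepMap.IsNowhereTrivial T) :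
    ∃ h : Y → X, SepMap.IsSupportMap T h ∧
      (∀ i : Fin n, IsOpen (SepMap.goodSet T h i) ∧ Dense (SepMap.goodSet T h i) ∧
        SepMap.IsCkOn q (X := (Y : Set H))
          (fun y => (h y : EuclideanSpace ℝ (Fin n)) i) (SepMap.goodSet T h i)) ∧
      IsOpen (⋂ i : Fin n, SepMap.goodSet T h i) ∧
      Dense (⋂ i : Fin n, SepMap.goodSet T h i) ∧
      SepMap.IsCkOn q (X := (Y : Set H))
        (fun y => (h y : EuclideanSpace ℝ (Fin n))) (⋂ i : Fin n, SepMap.goodSet T h i) := by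
  choose h hh using fun y => SepMap.exists_isSuppPt T (hnt y)
  have hc := SepMap.continuous_of_isSuppPt hsep hh
  have hopen := SepMap.isOpen_goodSet T hc
  have hdense := SepMap.dense_goodSet hsep hnt hh
  have hbaire : BaireSpace Y := Y.isOpen.baireSpace
  refine ⟨h, SepMap.isSupportMap_of_isSuppPt hsep hh, fun i => ⟨hopen i, hdense i, ?_⟩,
    isOpen_iInter_of_finite hopen, dense_iInter_of_isOpen hopen hdense, ?_⟩
  · rintro _ ⟨y, hy, rfl⟩
    exact (SepMap.contDiffAt_supportMap_coord hsep hh hy).contDiffWithinAt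
  · refine contDiffOn_euclidean.mpr fun i => ?_
    rintro _ ⟨y, hy, rfl⟩
    refine (SepMap.contDiffAt_supportMap_coord hsep hh
      (mem_iInter.mp hy i)).contDiffWithinAt.congr_of_eventuallyEq_of_mem ?_ ⟨y, hy, rfl⟩
    refine Filter.Eventually.of_forall fun z => ?_
    beta_reduce
    by_cases hz : z ∈ (Y : Set H)
    · rw [SepMap.zeroExt_apply _ ⟨z, hz⟩, SepMap.zeroExt_apply _ ⟨z, hz⟩]
    · rw [SepMap.zeroExt_of_notMem _ hz, SepMap.zeroExt_of_notMem _ hz]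
      rfl

end
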